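/- **Theorem.** For $\phi\in L^2(\mathbb{R})$ let $\widehat\phi$ be its $L^2$ (Plancherel) Fourier transform, normalized by $\widehat\phi(w)=\int_{\mathbb{R}}\phi(x)e^{-2\pi i wx}\,dx$. Let $\mathcal{A}$ be the class of real-valued continuous functions $\phi$ on $\mathbb{R}$ such that (i) $\phi$ is differentiable except at a finite number of points; (ii) for some $\epsilon>0$, $\phi(x)=\mathcal{O}(|x|^{-0.5-\epsilon})$ and $\phi'(x)=\mathcal{O}(|x|^{-0.5-\epsilon})$ as $x\to\pm\infty$ (so $\phi\in L^2(\mathbb{R})$); (iii) for all $h>0$, $\displaystyle\operatorname*{ess\,sup}_{w\in[0,1/h]}\sum_{l\in\mathbb{Z}}\left(w+\tfrac lh\right)^2\left|\widehat\phi\left(w+\tfrac lh\right)\right|^2<\infty$. For $h>0$ let $V_h(\phi)$ be the set of all $f\in L^2(\mathbb{R})$ of the form $f=\sum_{k\in\mathbb{Z}}d_k\phi(\cdot-hk)$ (convergence in $L^2(\mathbb{R})$) with $(d_k)\in\ell^2(\mathbb{Z})$. Call $\phi$ a stable generator for $V_h(\phi)$ if $\{\phi(\cdot-hk):k\in\mathbb{Z}\}$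 is a Riesz basis for $V_h(\phi)$, i.e. its closed linear span is $V_h(\phi)$ and there are constants $A,B>0$ such that $A\sum_k|d_k|^2\le\big\|\sum_k d_k\phi(\cdot-hk)\big\|^2\le B\sum_k|d_k|^2$ for all $(d_k)\in\ell^2(\mathbb{Z})$. Put $$M_{\phi,h}:=\operatorname*{ess\,sup}_{w\in[0,1/h]}\frac{\sum_{l\in\mathbb{Z}}(w+\frac lh)^2|\widehat\phi(w+\frac lh)|^2}{\sum_{l\in\mathbb{Z}}|\widehat\phi(w+\frac lh)|^2}.$$ Let $\beta>0$ and let $\phi\in\mathcal{A}$ be a stable generator for $V_{1/\beta}(\phi)$. If $0<\alpha<\dfrac1{2\sqrt{M_{\phi,1/\beta}}}$, then $\mathcal{G}(\phi,\alpha,\beta)=\{e^{2\pi i\beta m\,\cdot}\phi(\cdot-\alpha k):k,m\in\mathbb{Z}\}$ is a frame for $L^2(\mathbb{R})$ with frame bounds $$A(\alpha,\beta)=\tfrac1\alpha\left(1-2\alpha\sqrt{M_{\phi,1/\beta}}\right)^2\operatorname*{ess\,inf}_{\xi\in[0,\beta]}\sum_{k\in\mathbb{Z}}|\widehat\phi(\xi+\beta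 k)|^2,$$ $$B(\alpha,\beta)=\tfrac1\alpha\left(1+2\alpha\sqrt{M_{\phi,1/\beta}}\right)^2\operatorname*{ess\,sup}_{\xi\in[0,\beta]}\sum_{k\in\mathbb{Z}}|\widehat\phi(\xi+\beta k)|^2,$$ that is, $A(\alpha,\beta)$ and $B(\alpha,\beta)$ are positive real numbers and $A(\alpha,\beta)\|f\|^2\le\sum_{k,m\in\mathbb{Z}}|\langle f,e^{2\pi i\beta m\,\cdot}\phi(\cdot-\alpha k)\rangle|^2\le B(\alpha,\beta)\|f\|^2$ for every $f\in L^2(\mathbb{R})$. -/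

import Mathlib

open MeasureTheory Filter Asymptotics FourierTransform
open scoped ENNReal

noncomputable section

/-- The complex Hilbert space `L²(ℝ)` with respect to Lebesgue measure. -/
abbrev L2R : Type := Lp ℂ 2 (volume : Measure ℝ)

open Classical in
/-- The element of `L²(ℝ)` represented by a function `g : ℝ → ℂ`
(by convention `0` when `g` is not square integrable). -/
def toL2R (g : ℝ → ℂ) : L2R :=
  if hg : MemLp g 2 volume then hg.toLp g else 0

/-- The `L²(ℝ)` (Plancherel) Fourier transform of a real-valued function, normalized as
`φ̂ w = ∫ φ x * exp (-2 π i w x) dx` for integrable `φ`. It is determined up to a null set. -/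
def l2Fourier (φ : ℝ → ℝ) : ℝ → ℂ :=
  (𝓕 (toL2R fun x => (φ x : ℂ)) : L2R)

/-- `∑ l, |φ̂ (w + l / h)| ^ 2`, as an extended nonnegative real. -/
def periodization (φ : ℝ → ℝ) (h w : ℝ) : ℝ≥0∞ :=
  ∑' l : ℤ, ‖l2Fourier φ (w + l / h)‖ₑ ^ 2

/-- `∑ l, (w + l / h) ^ 2 * |φ̂ (w + l / h)| ^ 2`, as an extended nonnegative real. -/
def momentPeriodization (φ : ℝ → ℝ) (h w : ℝ) : ℝ≥0∞ :=
  ∑' l : ℤ, ENNReal.ofReal ((w + l / h) ^ 2) * ‖l2Fourier φ (w + l / h)‖ₑ ^ 2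

/-- The class `𝒜` of windows. -/
structure ClassA (φ : ℝ → ℝ) : Prop where
  continuous : Continuous φ
  finite_not_differentiable : {x : ℝ | ¬ DifferentiableAt ℝ φ x}.Finite
  decay : ∃ ε : ℝ, 0 < ε ∧
    (φ =O[atTop] fun x : ℝ => |x| ^ (-(1 / 2 : ℝ) - ε)) ∧
    (φ =O[atBot] fun x : ℝ => |x| ^ (-(1 / 2 : ℝ) - ε)) ∧
    (deriv φ =O[atTop] fun x : ℝ => |x| ^ (-(1 / 2 : ℝ) - ε)) ∧
    (deriv φ =O[atBot] fun x : ℝ => |x| ^ (-(1 / 2 : ℝ) - ε))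
  moment : ∀ h : ℝ, 0 < h →
    essSup (momentPeriodization φ h) (volume.restrict (Set.Icc 0 (1 / h))) < ∞

/-- The translate `φ(· - h k)` in `L²(ℝ)`. -/
def shiftL2R (φ : ℝ → ℝ) (h : ℝ) (k : ℤ) : L2R :=
  toL2R fun x => (φ (x - h * k) : ℂ)

/-- The shift-invariant space `V_h(φ)`: all `f ∈ L²(ℝ)` of the form
`f = ∑ k, d k • φ(· - h k)` (in `L²(ℝ)`) with `d ∈ ℓ²(ℤ)`. -/
def shiftInvariantSpace (φ : ℝ → ℝ) (h : ℝ) : Set L2R :=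
  {f | ∃ d : lp (fun _ : ℤ => ℂ) 2, HasSum (fun k : ℤ => d k • shiftL2R φ h k) f}

/-- `φ` is a stable generator for `V_h(φ)`: the translates `φ(· - h k)` form a Riesz basis
of `V_h(φ)`. -/
def IsStableGenerator (φ : ℝ → ℝ) (h : ℝ) : Prop :=
  closure (Submodule.span ℂ (Set.range (shiftL2R φ h)) : Set L2R) = shiftInvariantSpace φ h ∧
  ∃ A B : ℝ, 0 < A ∧ 0 < B ∧ ∀ d : lp (fun _ : ℤ => ℂ) 2,
    ∃ f : L2R, HasSum (fun k : ℤ => d k • shiftL2R φ h k) f ∧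
      A * ∑' k : ℤ, ‖d k‖ ^ 2 ≤ ‖f‖ ^ 2 ∧ ‖f‖ ^ 2 ≤ B * ∑' k : ℤ, ‖d k‖ ^ 2

/-- The quotient `B_{φ,h}(w)`. -/
def bernsteinQuotient (φ : ℝ → ℝ) (h w : ℝ) : ℝ≥0∞ :=
  momentPeriodization φ h w / periodization φ h w

/-- `M_{φ,h}`, the essential supremum of `B_{φ,h}` over `[0, 1/h]`. -/
def bernsteinConst (φ : ℝ → ℝ) (h : ℝ) : ℝ :=
  (essSup (bernsteinQuotient φ h) (volume.restrict (Set.Icc 0 (1 / h)))).toReal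

/-- The element `x ↦ exp (2 π i β m x) * φ (x - α k)` of the Gabor system `𝒢(φ, α, β)`,
indexed by `(k, m) ∈ ℤ × ℤ`. -/
def gaborSystem (φ : ℝ → ℝ) (α β : ℝ) (p : ℤ × ℤ) : L2R :=
  toL2R fun x =>
    Complex.exp (2 * Real.pi * Complex.I * β * p.2 * x) * (φ (x - α * p.1) : ℂ)

/-- The family `e` is a frame for `L²(ℝ)` with frame bounds `A` and `B`. -/
def IsFrameWithBounds {ι : Type*} (e : ι → L2R) (A B : ℝ) : Prop :=
  0 < A ∧ 0 < B ∧ ∀ f : L2R,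
    Summable (fun i => ‖inner ℂ (e i) f‖ ^ 2) ∧
    A * ‖f‖ ^ 2 ≤ ∑' i, ‖inner ℂ (e i) f‖ ^ 2 ∧
    ∑' i, ‖inner ℂ (e i) f‖ ^ 2 ≤ B * ‖f‖ ^ 2

/-- `∑ k, |φ̂ (ξ + β k)| ^ 2`, as an extended nonnegative real. -/
def fourierPeriodization (φ : ℝ → ℝ) (β ξ : ℝ) : ℝ≥0∞ :=
  ∑' k : ℤ, ‖l2Fourier φ (ξ + β * k)‖ₑ ^ 2

/-- The windows of the class `𝒜` are square integrable, so that the convention in `toL2R`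
plays no role for them. -/
theorem ClassA.memLp {φ : ℝ → ℝ} (hφ : ClassA φ) :
    MemLp (fun x => (φ x : ℂ)) 2 volume := by
  obtain ⟨ε, hε, h1, h2, -, -⟩ := hφ.decay
  have hc : Continuous fun x => (φ x : ℂ) := Complex.continuous_ofReal.comp hφ.continuous
  rw [memLp_two_iff_integrable_sq_norm hc.aestronglyMeasurable]
  have hsq : ∀ x : ℝ, (|x| ^ (-(1 / 2 : ℝ) - ε)) ^ 2 = |x| ^ (-1 - 2 * ε) := fun x => by
    rw [← Real.rpow_natCast, ← Real.rpow_mul (abs_nonneg x)]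
    congr 1
    push_cast
    ring
  have hn : (fun x => ‖(φ x : ℂ)‖ ^ 2) = fun x => (φ x) ^ 2 := by
    funext x
    simp
  rw [hn]
  have hI : IntegrableOn (fun x : ℝ => |x| ^ (-1 - 2 * ε)) (Set.Ioi 1) volume := by
    refine (integrableOn_Ioi_rpow_of_lt (a := -1 - 2 * ε) (by linarith) one_pos).congr_fun
      (fun x hx => ?_) measurableSet_Ioi
    rw [Set.mem_Ioi] at hx
    simp only [abs_of_nonneg (zero_le_one.trans hx.le)]
  have hT : IntegrableAtFilter (fun x : ℝ => |x| ^ (-1 - 2 * ε)) atTop volume :=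
    ⟨Set.Ioi 1, Ioi_mem_atTop 1, hI⟩
  have hl : LocallyIntegrable (fun x => (φ x) ^ 2) (volume : Measure ℝ) :=
    (hφ.continuous.pow 2).locallyIntegrable
  have hB : IntegrableAtFilter (fun x : ℝ => |x| ^ (-1 - 2 * ε)) atBot volume := by
    refine ⟨Set.Iio (-1), Iio_mem_atBot (-1), ?_⟩
    have := ((Measure.measurePreserving_neg (volume : Measure ℝ)).integrableOn_comp_preimage
      (Homeomorph.neg ℝ).measurableEmbedding).2 hI
    simpa [Function.comp_def] using this
  refine hl.integrable_of_isBigO_atBot_atTop ?_ hB ?_ hT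
  · simpa only [hsq] using h2.pow 2
  · simpa only [hsq] using h1.pow 2

end

/-! The frame inequalities reduce to a sampling theorem in the shift-invariant space. Let `f` be
continuous with compact support. For fixed `k`, Parseval in `m` on a period of length `1/β` turns
the frame sum into `1/β` times the integral over `x ∈ (0, 1/β]` of `∑ k, |G (x - α k)|²`, where `G =
∑ j, f (x - j/β) φ(· - j/β)` is a finite combination of translates
(`ClassA.tsum_sq_inner_gaborSystem`).

Write `D` for the trigonometric polynomial with the coefficients of `G`. The transform of `G` is `D
φ̂` with `|D|` periodic of period `β`, so Plancherel and unfolding give `‖G‖²` and `‖G'‖²` as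
integrals of `|D|²` over one period against the periodizations of `|φ̂|²` and of `(2πw)²|φ̂|²`.
Comparing the two densities yields the Bernstein inequality `‖G'‖ ≤ 2π √M ‖G‖`.

Let `S` be the step function equal to `G` at the nearest sample point. Wirtinger's inequality with
one free end, used on both halves of each cell of length `α`, gives `‖G - S‖ ≤ (α/π) ‖G'‖ ≤ θ ‖G‖`
with `θ = 2α√M < 1`. Since `‖S‖² = α ∑ |G(x - α k)|²`, the triangle inequality gives the factors `(1
± θ)²` (`sampling_inequality`). Finally `‖G‖²` lies between the essential bounds of the
periodization times `β ∑ |f (x - j/β)|²`, and integration over `x` recovers `‖f‖²`. Density extends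
the result to `L²`.

The Riesz inequalities make the essential bounds positive and finite: tested on all trigonometric
polynomials, they become pointwise bounds (`ae_le_of_trigPoly`). -/

/-! ### Plancherel transforms as integrals, and primitives of `L²` functions -/

theorem integral_fourier_mul_eq {f g : ℝ → ℂ} (hf : Integrable f) (hg : Integrable g) :
    ∫ x, 𝓕 f x * g x = ∫ x, f x * 𝓕 g x := by
  simpa using! VectorFourier.integral_fourierIntegral_smul_eq_flip (L := innerₗ ℝ)
    Real.continuous_fourierChar continuous_inner hf hg

theorem integral_fourierInv_mul_eq {f g : ℝ → ℂ} (hf : Integrable f) (hg : Integrable g) :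
    ∫ x, 𝓕⁻ f x * g x = ∫ x, f x * 𝓕⁻ g x := by
  simp_rw [Real.fourierInv_eq_fourier_neg]
  rw [← integral_neg_eq_self]
  simp only [neg_neg]
  rw [integral_fourier_mul_eq hf hg.comp_neg]
  congr! 3 with x
  rw [← Real.fourierInv_eq_fourier_neg, Real.fourierInv_eq_fourier_comp_neg]

theorem continuous_fourier_of_integrable {f : ℝ → ℂ} (hf : Integrable f) : Continuous (𝓕 f) :=
  VectorFourier.fourierIntegral_continuous Real.continuous_fourierChar continuous_inner hf

theorem continuous_fourierInv_of_integrable {f : ℝ → ℂ} (hf : Integrable f) :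
    Continuous (𝓕⁻ f) := by
  have : 𝓕⁻ f = fun x => 𝓕 f (-x) := funext fun x => Real.fourierInv_eq_fourier_neg f x
  rw [this]
  exact (continuous_fourier_of_integrable hf).comp continuous_neg

/-- On `L¹ ∩ L²` the Plancherel transform is given by the Fourier integral. -/
theorem coeFn_fourier_toLp {f : ℝ → ℂ} (hf : Integrable f) (hf2 : MemLp f 2) :
    (𝓕 (hf2.toLp f) : L2R) =ᵐ[volume] 𝓕 f := by
  -- Both sides are locally integrable, so it suffices to test them against smooth compactly
  -- supported functions. These are Schwartz, and the transform as a tempered distribution is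
  -- defined by duality.
  refine ae_eq_of_integral_contDiff_smul_eq ((Lp.memLp _).locallyIntegrable (by norm_num))
    (continuous_fourier_of_integrable hf).locallyIntegrable fun g hg hgc => ?_
  have hc : HasCompactSupport (fun x => (g x : ℂ)) := hgc.comp_left Complex.ofReal_zero
  have hd : ContDiff ℝ (⊤ : ℕ∞) (fun x => (g x : ℂ)) := Complex.ofRealCLM.contDiff.comp hg
  set ψ := hc.toSchwartzMap hd
  have key := DFunLike.congr_fun (Lp.fourier_toTemperedDistribution_eq (hf2.toLp f)) ψ
  rw [TemperedDistribution.fourier_apply, Lp.toTemperedDistribution_apply,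
    Lp.toTemperedDistribution_apply] at key
  have hψ : ∀ x, ψ x = (g x : ℂ) := fun x => rfl
  calc ∫ x, g x • (𝓕 (hf2.toLp f) : L2R) x
      = ∫ x, ψ x • (𝓕 (hf2.toLp f) : L2R) x := by simp [hψ]
    _ = ∫ x, 𝓕 ψ x • (hf2.toLp f : L2R) x := key.symm
    _ = ∫ x, f x * 𝓕 (ψ : ℝ → ℂ) x := by
      refine integral_congr_ae ?_
      filter_upwards [hf2.coeFn_toLp] with x hx
      rw [hx, SchwartzMap.fourier_coe, smul_eq_mul, mul_comm]
    _ = ∫ x, g x • 𝓕 f x := by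
      rw [← integral_fourier_mul_eq hf ψ.integrable]
      simp [hψ, mul_comm]

/-- On `L¹ ∩ L²` the inverse Plancherel transform is given by the inverse Fourier integral. -/
theorem coeFn_fourierInv_toLp {f : ℝ → ℂ} (hf : Integrable f) (hf2 : MemLp f 2) :
    (𝓕⁻ (hf2.toLp f) : L2R) =ᵐ[volume] 𝓕⁻ f := by
  refine ae_eq_of_integral_contDiff_smul_eq ((Lp.memLp _).locallyIntegrable (by norm_num))
    (continuous_fourierInv_of_integrable hf).locallyIntegrable fun g hg hgc => ?_
  have hc : HasCompactSupport (fun x => (g x : ℂ)) := hgc.comp_left Complex.ofReal_zero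
  have hd : ContDiff ℝ (⊤ : ℕ∞) (fun x => (g x : ℂ)) := Complex.ofRealCLM.contDiff.comp hg
  set ψ := hc.toSchwartzMap hd
  have key := DFunLike.congr_fun (Lp.fourierInv_toTemperedDistribution_eq (hf2.toLp f)) ψ
  rw [TemperedDistribution.fourierInv_apply, Lp.toTemperedDistribution_apply,
    Lp.toTemperedDistribution_apply] at key
  have hψ : ∀ x, ψ x = (g x : ℂ) := fun x => rfl
  calc ∫ x, g x • (𝓕⁻ (hf2.toLp f) : L2R) x
      = ∫ x, ψ x • (𝓕⁻ (hf2.toLp f) : L2R) x := by simp [hψ]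
    _ = ∫ x, 𝓕⁻ ψ x • (hf2.toLp f : L2R) x := key.symm
    _ = ∫ x, f x * 𝓕⁻ (ψ : ℝ → ℂ) x := by
      refine integral_congr_ae ?_
      filter_upwards [hf2.coeFn_toLp] with x hx
      rw [hx, SchwartzMap.fourierInv_coe, smul_eq_mul, mul_comm]
    _ = ∫ x, g x • 𝓕⁻ f x := by
      rw [← integral_fourierInv_mul_eq hf ψ.integrable]
      simp [hψ, mul_comm]

/-- Keeping the factor `2πiw` on the left avoids a division by `w`; at `w = 0` both sides vanish. -/
theorem fourierInv_indicator_Ioc {a b w : ℝ} (hab : a ≤ b) :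
    2 * Real.pi * Complex.I * w * 𝓕⁻ ((Set.Ioc a b).indicator (1 : ℝ → ℂ)) w =
      Complex.exp (2 * Real.pi * Complex.I * w * b) -
        Complex.exp (2 * Real.pi * Complex.I * w * a) := by
  have h1 : 𝓕⁻ ((Set.Ioc a b).indicator (1 : ℝ → ℂ)) w =
      ∫ x in a..b, Complex.exp (2 * Real.pi * Complex.I * w * x) := by
    rw [intervalIntegral.integral_of_le hab, ← integral_indicator measurableSet_Ioc,
      Real.fourierInv_eq']
    congr 1
    ext x
    by_cases hx : x ∈ Set.Ioc a b
    · simp only [Set.indicator_of_mem hx, Pi.one_apply, smul_eq_mul, mul_one]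
      congr 1
      simp
      ring
    · simp [Set.indicator_of_notMem hx]
  rw [h1]
  by_cases hw : w = 0
  · simp [hw]
  · have hc : 2 * Real.pi * Complex.I * (w : ℂ) ≠ 0 := by
      simp [hw, Real.pi_ne_zero]
    rw [integral_exp_mul_complex hc]
    rw [mul_div_cancel₀ _ hc]

/-- The integral over `(a, b]` is an inner product with an indicator. Plancherel moves it to the
frequency side, where the factor `2πiw` turns the transform of the indicator into a difference of
exponentials. No pointwise derivative is involved. -/
theorem setIntegral_fourierInv_eq {g : ℝ → ℂ} (hg : Integrable g)
    (hwg : MemLp (fun w => 2 * Real.pi * Complex.I * w * g w) 2) {a b : ℝ} (hab : a ≤ b) :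
    𝓕⁻ g b - 𝓕⁻ g a = ∫ x in Set.Ioc a b, (𝓕⁻ (hwg.toLp _) : L2R) x := by
  have hi : Integrable ((Set.Ioc a b).indicator (1 : ℝ → ℂ)) :=
    (integrable_indicator_iff measurableSet_Ioc).2 (by simp [Pi.one_def])
  have hi2 : MemLp ((Set.Ioc a b).indicator (1 : ℝ → ℂ)) 2 :=
    memLp_indicator_const 2 measurableSet_Ioc (1 : ℂ) (by simp)
  set χ : L2R := hi2.toLp _
  set v : L2R := hwg.toLp _
  have h1 : ∫ x in Set.Ioc a b, (𝓕⁻ v : L2R) x = inner ℂ χ (𝓕⁻ v) := by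
    rw [L2.inner_def, ← integral_indicator measurableSet_Ioc]
    refine integral_congr_ae ?_
    filter_upwards [hi2.coeFn_toLp] with x hx
    rw [hx]
    by_cases hxm : x ∈ Set.Ioc a b <;> simp [hxm]
  have h2 : inner ℂ χ (𝓕⁻ v) = inner ℂ (𝓕 χ) v := by
    rw [← Lp.inner_fourier_eq, fourier_fourierInv_eq]
  have hexp : ∀ y : ℝ, Integrable fun w : ℝ =>
      Complex.exp (2 * Real.pi * Complex.I * w * y) * g w :=
    fun y => by
      refine (hg.norm).mono' (by fun_prop) (ae_of_all _ fun w => ?_)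
      rw [norm_mul, show 2 * (Real.pi : ℂ) * Complex.I * w * y =
        ((2 * Real.pi * w * y : ℝ) : ℂ) * Complex.I by push_cast; ring,
        Complex.norm_exp_ofReal_mul_I, one_mul]
  have hinv : ∀ y : ℝ, 𝓕⁻ g y = ∫ w : ℝ, Complex.exp (2 * Real.pi * Complex.I * w * y) * g w :=
    fun y => by
      rw [Real.fourierInv_eq']
      refine integral_congr_ae (ae_of_all _ fun w => ?_)
      simp only [smul_eq_mul]
      congr 2
      simp
      ring
  rw [h1, h2, L2.inner_def, hinv, hinv, ← integral_sub (hexp b) (hexp a)]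
  refine integral_congr_ae ?_
  filter_upwards [coeFn_fourier_toLp hi hi2, hwg.coeFn_toLp] with w h3 h4
  rw [h3, h4]
  have h5 : 𝓕⁻ ((Set.Ioc a b).indicator (1 : ℝ → ℂ)) w =
      (starRingEnd ℂ) (𝓕 ((Set.Ioc a b).indicator (1 : ℝ → ℂ)) w) := by
    rw [Real.fourierInv_eq', Real.fourier_eq', ← integral_conj]
    refine integral_congr_ae (ae_of_all _ fun x => ?_)
    by_cases hx : x ∈ Set.Ioc a b
    · simp [hx, ← Complex.exp_conj, map_ofNat]
    · simp [hx]
  have h6 := fourierInv_indicator_Ioc (w := w) hab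
  rw [h5] at h6
  simp only [RCLike.inner_apply]
  linear_combination -g w * h6

/-! ### Wirtinger's inequality -/

theorem sq_eLpNorm_two {X E : Type*} [MeasurableSpace X] [NormedAddCommGroup E] (μ : Measure X)
    (f : X → E) : eLpNorm f 2 μ ^ 2 = ∫⁻ x, ‖f x‖ₑ ^ 2 ∂μ := by
  rw [eLpNorm_eq_lintegral_rpow_enorm_toReal (by norm_num) (by norm_num), ← ENNReal.rpow_natCast,
    ← ENNReal.rpow_mul]
  norm_num

/-- Cauchy–Schwarz with a weight `k`. -/
theorem sq_lintegral_le_lintegral_mul_lintegral_div {X : Type*} [MeasurableSpace X]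
    {μ : Measure X} {k ρ : X → ℝ≥0∞} (hk : AEMeasurable k μ) (hρ : AEMeasurable ρ μ)
    (hk0 : ∀ᵐ x ∂μ, k x ≠ 0) (hkt : ∀ᵐ x ∂μ, k x ≠ ∞) :
    (∫⁻ x, ρ x ∂μ) ^ 2 ≤ (∫⁻ x, k x ∂μ) * ∫⁻ x, ρ x ^ 2 / k x ∂μ := by
  have h := ENNReal.lintegral_mul_le_Lp_mul_Lq μ (Real.HolderConjugate.two_two)
    (f := fun x => k x ^ (1 / 2 : ℝ)) (g := fun x => ρ x / k x ^ (1 / 2 : ℝ))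
    (hk.pow_const _) (hρ.div (hk.pow_const _))
  have h1 : ∫⁻ x, ((fun x => k x ^ (1 / 2 : ℝ)) * fun x => ρ x / k x ^ (1 / 2 : ℝ)) x ∂μ =
      ∫⁻ x, ρ x ∂μ := by
    refine lintegral_congr_ae ?_
    filter_upwards [hk0, hkt] with x h0 ht
    simp only [Pi.mul_apply]
    rw [ENNReal.mul_div_cancel] <;> simp [h0, ht]
  have h2 : ∀ x, (k x ^ (1 / 2 : ℝ)) ^ (2 : ℝ) = k x := fun x => by
    rw [← ENNReal.rpow_mul]; norm_num
  have h3 : ∀ x, (ρ x / k x ^ (1 / 2 : ℝ)) ^ (2 : ℝ) = ρ x ^ 2 / k x := fun x => by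
    rw [ENNReal.div_rpow_of_nonneg _ _ (by norm_num), h2, ENNReal.rpow_two]
  rw [h1] at h
  simp only [h2, h3] at h
  calc (∫⁻ x, ρ x ∂μ) ^ 2
      ≤ ((∫⁻ x, k x ∂μ) ^ (1 / 2 : ℝ) * (∫⁻ x, ρ x ^ 2 / k x ∂μ) ^ (1 / 2 : ℝ)) ^ 2 := by gcongr
    _ = _ := by
      rw [mul_pow, ← ENNReal.rpow_two, ← ENNReal.rpow_two, ← ENNReal.rpow_mul, ← ENNReal.rpow_mul]
      norm_num

/-- The sharp Wirtinger inequality on an interval with one free end, by Schur's test. -/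
theorem lintegral_sq_primitive_le {ρ : ℝ → ℝ≥0∞} (hρ : Measurable ρ) {l : ℝ} (hl : 0 < l) :
    ∫⁻ t in Set.Ioo 0 l, (∫⁻ s in Set.Ioc 0 t, ρ s) ^ 2 ≤
      ENNReal.ofReal ((2 * l / Real.pi) ^ 2) * ∫⁻ s in Set.Ioo 0 l, ρ s ^ 2 := by
  -- The extremal is `sin (c s)`, which vanishes at `0` and has zero derivative at the free end,
  -- whence `c l = π/2`. The Schur weight is its derivative up to scale, `cos (c s)`, and the
  -- constant is `1 / c²`.
  set c : ℝ := Real.pi / (2 * l) with hc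
  have hπ := Real.pi_pos
  have hc0 : 0 < c := by positivity
  have hcl : c * l = Real.pi / 2 := by rw [hc]; field_simp
  have hang : ∀ t ∈ Set.Ioo 0 l, 0 < c * t ∧ c * t < Real.pi / 2 := fun t ht =>
    ⟨mul_pos hc0 ht.1, by rw [← hcl]; exact mul_lt_mul_of_pos_left ht.2 hc0⟩
  have hcos : ∀ t ∈ Set.Ioo 0 l, 0 < Real.cos (c * t) := fun t ht =>
    Real.cos_pos_of_mem_Ioo ⟨by linarith [(hang t ht).1], (hang t ht).2⟩
  have hsin : ∀ t ∈ Set.Ioo 0 l, 0 < Real.sin (c * t) := fun t ht =>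
    Real.sin_pos_of_pos_of_lt_pi (hang t ht).1 (by linarith [(hang t ht).2])
  set k : ℝ → ℝ≥0∞ := fun s => ENNReal.ofReal (Real.cos (c * s))
  set S : ℝ → ℝ≥0∞ := fun t => ENNReal.ofReal (Real.sin (c * t) / c)
  have hkm : Measurable k := by fun_prop
  have hSm : Measurable S := by fun_prop
  have hq : Measurable fun s => ρ s ^ 2 / k s := (hρ.pow_const 2).div hkm
  have hstep : ∀ t ∈ Set.Ioo 0 l, (∫⁻ s in Set.Ioc 0 t, ρ s) ^ 2 ≤
      ∫⁻ s in Set.Ioo 0 l, S t * (Set.Iic t).indicator (fun s => ρ s ^ 2 / k s) s := by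
    intro t ht
    have hsub : Set.Ioc 0 t ⊆ Set.Ioo 0 l := fun s hs => ⟨hs.1, hs.2.trans_lt ht.2⟩
    have hk1 : ∫⁻ s in Set.Ioc 0 t, k s = S t := by
      rw [← ofReal_integral_eq_lintegral_ofReal, ← intervalIntegral.integral_of_le ht.1.le]
      · simp [S, intervalIntegral.integral_comp_mul_left _ hc0.ne', div_eq_inv_mul]
      · exact (Continuous.integrableOn_Icc (by fun_prop)).mono_set Set.Ioc_subset_Icc_self
      · filter_upwards [ae_restrict_mem measurableSet_Ioc] with s hs
        exact (hcos s (hsub hs)).le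
    calc (∫⁻ s in Set.Ioc 0 t, ρ s) ^ 2
        ≤ (∫⁻ s in Set.Ioc 0 t, k s) * ∫⁻ s in Set.Ioc 0 t, ρ s ^ 2 / k s := by
          refine sq_lintegral_le_lintegral_mul_lintegral_div hkm.aemeasurable hρ.aemeasurable ?_
            (ae_of_all _ fun s => ENNReal.ofReal_ne_top)
          filter_upwards [ae_restrict_mem measurableSet_Ioc] with s hs
          exact (ENNReal.ofReal_pos.2 (hcos s (hsub hs))).ne'
      _ = _ := by
          rw [hk1, lintegral_const_mul _ (hq.indicator measurableSet_Iic),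
            lintegral_indicator measurableSet_Iic, Measure.restrict_restrict measurableSet_Iic]
          congr 3
          ext s
          simp only [Set.mem_Ioc, Set.mem_inter_iff, Set.mem_Iic, Set.mem_Ioo]
          exact ⟨fun h => ⟨h.2, h.1, h.2.trans_lt ht.2⟩, fun h => ⟨h.2.1, h.1⟩⟩
  have hjoint : Measurable fun z : ℝ × ℝ =>
      S z.1 * (Set.Iic z.1).indicator (fun s => ρ s ^ 2 / k s) z.2 := by
    refine (hSm.comp measurable_fst).mul ?_
    have : (fun z : ℝ × ℝ => (Set.Iic z.1).indicator (fun s => ρ s ^ 2 / k s) z.2) =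
        {z : ℝ × ℝ | z.2 ≤ z.1}.indicator fun z => ρ z.2 ^ 2 / k z.2 := by
      ext z; by_cases h : z.2 ≤ z.1 <;> simp [h]
    rw [this]
    exact (hq.comp measurable_snd).indicator (measurableSet_le measurable_snd measurable_fst)
  calc ∫⁻ t in Set.Ioo 0 l, (∫⁻ s in Set.Ioc 0 t, ρ s) ^ 2
      ≤ ∫⁻ t in Set.Ioo 0 l, ∫⁻ s in Set.Ioo 0 l,
          S t * (Set.Iic t).indicator (fun s => ρ s ^ 2 / k s) s :=
        setLIntegral_mono' measurableSet_Ioo hstep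
    _ = ∫⁻ s in Set.Ioo 0 l, ∫⁻ t in Set.Ioo 0 l,
          S t * (Set.Iic t).indicator (fun s => ρ s ^ 2 / k s) s :=
        lintegral_lintegral_swap hjoint.aemeasurable
    _ = ∫⁻ s in Set.Ioo 0 l, ENNReal.ofReal ((2 * l / Real.pi) ^ 2) * ρ s ^ 2 := by
        refine setLIntegral_congr_fun measurableSet_Ioo fun s hs => ?_
        have hind : ∀ t, S t * (Set.Iic t).indicator (fun s => ρ s ^ 2 / k s) s =
            (Set.Ici s).indicator S t * (ρ s ^ 2 / k s) := fun t => by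
          by_cases h : s ≤ t <;> simp [h]
        -- As `cos (c l) = 0`, integrating the primitive of `k` over `[s, l]` returns `k s / c²`.
        -- This cancels the `k s` in the denominator.
        have hS1 : ∫⁻ t in Set.Ioo 0 l, (Set.Ici s).indicator S t =
            ENNReal.ofReal (Real.cos (c * s) / c ^ 2) := by
          rw [lintegral_indicator measurableSet_Ici, Measure.restrict_restrict measurableSet_Ici]
          have : Set.Ici s ∩ Set.Ioo 0 l = Set.Ico s l := by
            ext t
            simp only [Set.mem_Ico, Set.mem_inter_iff, Set.mem_Ici, Set.mem_Ioo]
            exact ⟨fun h => ⟨h.1, h.2.2⟩, fun h => ⟨h.1, hs.1.trans_le h.1, h.2⟩⟩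
          rw [this, restrict_Ico_eq_restrict_Ioc, ← ofReal_integral_eq_lintegral_ofReal,
            ← intervalIntegral.integral_of_le hs.2.le]
          · congr 1
            rw [intervalIntegral.integral_div,
              intervalIntegral.integral_comp_mul_left _ hc0.ne', integral_sin, hcl,
              Real.cos_pi_div_two, smul_eq_mul]
            field_simp
            ring
          · exact (Continuous.integrableOn_Icc (by fun_prop)).mono_set Set.Ioc_subset_Icc_self
          · rw [← restrict_Ico_eq_restrict_Ioc]
            filter_upwards [ae_restrict_mem measurableSet_Ico] with t ht
            exact (div_pos (hsin t ⟨hs.1.trans_le ht.1, ht.2⟩) hc0).le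
        simp_rw [hind]
        rw [lintegral_mul_const _ (hSm.indicator measurableSet_Ici), hS1]
        have hk0 : k s ≠ 0 := (ENNReal.ofReal_pos.2 (hcos s hs)).ne'
        have : ENNReal.ofReal (Real.cos (c * s) / c ^ 2) =
            ENNReal.ofReal ((2 * l / Real.pi) ^ 2) * k s := by
          rw [← ENNReal.ofReal_mul (by positivity)]
          congr 1
          rw [hc]; field_simp
        rw [this, mul_assoc, ENNReal.mul_div_cancel hk0 ENNReal.ofReal_ne_top]
    _ = _ := lintegral_const_mul _ (hρ.pow_const 2)

theorem setLIntegral_enorm_sub_sq_le_right {u : ℝ → ℂ} {ρ : ℝ → ℝ≥0∞} (hρ : Measurable ρ)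
    (hu : ∀ a b, a ≤ b → ‖u b - u a‖ₑ ≤ ∫⁻ s in Set.Ioc a b, ρ s) {l : ℝ} (hl : 0 < l) (y : ℝ) :
    ∫⁻ t in Set.Ioc 0 l, ‖u (y + t) - u y‖ₑ ^ 2 ≤
      ENNReal.ofReal ((2 * l / Real.pi) ^ 2) * ∫⁻ t in Set.Ioc 0 l, ρ (y + t) ^ 2 := by
  rw [← restrict_Ioo_eq_restrict_Ioc]
  refine le_trans (setLIntegral_mono' measurableSet_Ioo fun t ht => ?_)
    (lintegral_sq_primitive_le (hρ.comp (measurable_const_add y)) hl)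
  gcongr
  refine (hu y (y + t) (by linarith [ht.1])).trans_eq ?_
  rw [← (measurePreserving_add_left volume y).setLIntegral_comp_preimage_emb
    (measurableEmbedding_addLeft y)]
  simp

/-- The value is pinned at the midpoint `y`, so each half is an interval with one free end, the left
one after reflection. The constant therefore involves the half-length `l`. -/
theorem setLIntegral_enorm_sub_sq_le {u : ℝ → ℂ} {ρ : ℝ → ℝ≥0∞} (hρ : Measurable ρ)
    (hu : ∀ a b, a ≤ b → ‖u b - u a‖ₑ ≤ ∫⁻ s in Set.Ioc a b, ρ s) {l : ℝ} (hl : 0 < l) (y : ℝ) :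
    ∫⁻ t in Set.Ioc (-l) l, ‖u (y + t) - u y‖ₑ ^ 2 ≤
      ENNReal.ofReal ((2 * l / Real.pi) ^ 2) * ∫⁻ t in Set.Ioc (-l) l, ρ (y + t) ^ 2 := by
  have hneg : ∀ g : ℝ → ℝ≥0∞, ∀ a b : ℝ,
      ∫⁻ s in Set.Ioc a b, g (-s) = ∫⁻ s in Set.Ioc (-b) (-a), g s := fun g a b => by
    rw [← (Measure.measurePreserving_neg volume).setLIntegral_comp_preimage_emb
      (Homeomorph.neg ℝ).measurableEmbedding]
    simp [restrict_Ico_eq_restrict_Ioc]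
  have hsplit : ∀ g : ℝ → ℝ≥0∞, ∫⁻ t in Set.Ioc (-l) l, g t =
      (∫⁻ t in Set.Ioc 0 l, g (-t)) + ∫⁻ t in Set.Ioc 0 l, g t := fun g => by
    rw [hneg, neg_zero, ← Set.Ioc_union_Ioc_eq_Ioc (show -l ≤ 0 by linarith) hl.le,
      lintegral_union measurableSet_Ioc]
    exact Set.Ioc_disjoint_Ioc_of_le le_rfl
  rw [hsplit, hsplit, mul_add]
  refine add_le_add ?_ (setLIntegral_enorm_sub_sq_le_right hρ hu hl y)
  have := setLIntegral_enorm_sub_sq_le_right (u := fun x => u (-x)) (ρ := fun x => ρ (-x))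
    (hρ.comp measurable_neg) (fun a b hab => ?_) hl (-y)
  · simpa [add_comm] using this
  · rw [hneg, enorm_sub_rev]
    exact hu _ _ (by linarith)

/-! ### Decomposition into cells and regular sampling -/

theorem lintegral_eq_tsum_setLIntegral_Ioc {T : ℝ} (hT : 0 < T) (a : ℝ) (g : ℝ → ℝ≥0∞) :
    ∫⁻ x, g x = ∑' j : ℤ, ∫⁻ x in Set.Ioc a (a + T), g (x + j * T) := by
  rw [← setLIntegral_univ, ← iUnion_Ioc_add_zsmul hT a,
    lintegral_iUnion (fun _ => measurableSet_Ioc) (Set.pairwise_disjoint_Ioc_add_zsmul a T)]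
  refine tsum_congr fun j => ?_
  rw [← (measurePreserving_add_right volume ((j : ℝ) * T)).setLIntegral_comp_preimage_emb
    (measurableEmbedding_addRight _)]
  congr 2
  ext x
  simp only [zsmul_eq_mul, Set.mem_preimage, Set.mem_Ioc, Int.cast_add, Int.cast_one]
  constructor <;> rintro ⟨h1, h2⟩ <;> constructor <;> linarith

theorem lintegral_eq_setLIntegral_tsum_Ioc {T : ℝ} (hT : 0 < T) (a : ℝ) {g : ℝ → ℝ≥0∞}
    (hg : Measurable g) :
    ∫⁻ x, g x = ∫⁻ x in Set.Ioc a (a + T), ∑' j : ℤ, g (x + j * T) := by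
  rw [lintegral_eq_tsum_setLIntegral_Ioc hT a, lintegral_tsum]
  exact fun j => (hg.comp (measurable_add_const _)).aemeasurable

/-- The step function with the values of `u` at the points `k α`. -/
noncomputable def sampleStep (u : ℝ → ℂ) (α y : ℝ) : ℂ := u (α * ⌈y / α - 1 / 2⌉)

/-- The ceiling of `y/α - 1/2` rounds to the nearest integer with ties going down, which matches
cells open on the left and closed on the right. -/
theorem sampleStep_add {u : ℝ → ℂ} {α : ℝ} (hα : 0 < α) {t : ℝ}
    (ht : t ∈ Set.Ioc (-(α / 2)) (-(α / 2) + α)) (k : ℤ) :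
    sampleStep u α (t + k * α) = u (α * k) := by
  have : ⌈(t + k * α) / α - 1 / 2⌉ = k := by
    rw [Int.ceil_eq_iff]
    have h1 : (t + k * α) / α = t / α + k := by field_simp
    have h2 : -(1 / 2) < t / α := by rw [lt_div_iff₀ hα]; linarith [ht.1]
    have h3 : t / α ≤ 1 / 2 := by rw [div_le_iff₀ hα]; linarith [ht.2]
    rw [h1]
    constructor <;> linarith
  rw [sampleStep, this]

theorem lintegral_enorm_sampleStep_sq {u : ℝ → ℂ} {α : ℝ} (hα : 0 < α) :
    ∫⁻ y, ‖sampleStep u α y‖ₑ ^ 2 = ENNReal.ofReal α * ∑' k : ℤ, ‖u (α * k)‖ₑ ^ 2 := by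
  rw [lintegral_eq_tsum_setLIntegral_Ioc hα (-(α / 2)), ← ENNReal.tsum_mul_left]
  refine tsum_congr fun k => ?_
  rw [setLIntegral_congr_fun measurableSet_Ioc
    (fun t ht => by rw [sampleStep_add hα ht] : Set.EqOn _ (fun _ => ‖u (α * k)‖ₑ ^ 2) _),
    setLIntegral_const, Real.volume_Ioc, mul_comm]
  simp

/-- Cells centred at the sample points have half-length `α/2`, so the Wirtinger constant is
`2(α/2)/π = α/π`. -/
theorem lintegral_enorm_sub_sampleStep_sq_le {u : ℝ → ℂ} {ρ : ℝ → ℝ≥0∞} (hρ : Measurable ρ)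
    (hu : ∀ a b, a ≤ b → ‖u b - u a‖ₑ ≤ ∫⁻ s in Set.Ioc a b, ρ s) {α : ℝ} (hα : 0 < α) :
    ∫⁻ y, ‖u y - sampleStep u α y‖ₑ ^ 2 ≤
      ENNReal.ofReal ((α / Real.pi) ^ 2) * ∫⁻ y, ρ y ^ 2 := by
  rw [lintegral_eq_tsum_setLIntegral_Ioc hα (-(α / 2)),
    lintegral_eq_tsum_setLIntegral_Ioc hα (-(α / 2)) fun y => ρ y ^ 2, ← ENNReal.tsum_mul_left]
  refine ENNReal.tsum_le_tsum fun k => ?_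
  have := setLIntegral_enorm_sub_sq_le hρ hu (half_pos hα) (k * α)
  rw [setLIntegral_congr_fun (g := fun t => ‖u (k * α + t) - u (k * α)‖ₑ ^ 2) measurableSet_Ioc
    (fun t ht => by simp only [sampleStep_add hα ht]; rw [add_comm, mul_comm α])]
  simpa [add_comm, show α + -(α / 2) = α / 2 by ring, show 2 * (α / 2) = α by ring] using this

theorem measurable_sampleStep {u : ℝ → ℂ} (hu : Measurable u) (α : ℝ) :
    Measurable (sampleStep u α) := by
  unfold sampleStep
  fun_prop

/-- Regular sampling of a function satisfying the Bernstein inequality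
`‖u'‖ ≤ (π θ / α) ‖u‖` with `θ < 1`. -/
theorem sampling_inequality {u : ℝ → ℂ} (hum : Measurable u) (hu2 : MemLp u 2)
    {ρ : ℝ → ℝ≥0∞} (hρ : Measurable ρ)
    (hu : ∀ a b, a ≤ b → ‖u b - u a‖ₑ ≤ ∫⁻ s in Set.Ioc a b, ρ s) {α θ : ℝ} (hα : 0 < α)
    (hθ0 : 0 ≤ θ) (hθ : θ ≤ 1)
    (hb : ENNReal.ofReal ((α / Real.pi) ^ 2) * ∫⁻ y, ρ y ^ 2 ≤
      ENNReal.ofReal (θ ^ 2) * ∫⁻ y, ‖u y‖ₑ ^ 2) :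
    ENNReal.ofReal ((1 - θ) ^ 2) * ∫⁻ y, ‖u y‖ₑ ^ 2 ≤
        ENNReal.ofReal α * ∑' k : ℤ, ‖u (α * k)‖ₑ ^ 2 ∧
      ENNReal.ofReal α * ∑' k : ℤ, ‖u (α * k)‖ₑ ^ 2 ≤
        ENNReal.ofReal ((1 + θ) ^ 2) * ∫⁻ y, ‖u y‖ₑ ^ 2 := by
  have hSm : AEStronglyMeasurable (sampleStep u α) volume :=
    (measurable_sampleStep hum α).aestronglyMeasurable
  -- The step function is within `θ ‖u‖` of `u`; both claims are then the triangle inequality,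
  -- squared.
  have hd : eLpNorm (u - sampleStep u α) 2 volume ≤ ENNReal.ofReal θ * eLpNorm u 2 volume := by
    rw [← ENNReal.pow_le_pow_left_iff two_ne_zero, mul_pow, sq_eLpNorm_two, sq_eLpNorm_two,
      ← ENNReal.ofReal_pow hθ0]
    exact (lintegral_enorm_sub_sampleStep_sq_le hρ hu hα).trans hb
  have h1 : eLpNorm u 2 volume ≤ eLpNorm (u - sampleStep u α) 2 volume +
      eLpNorm (sampleStep u α) 2 volume := by
    simpa using eLpNorm_add_le (hum.aestronglyMeasurable.sub hSm) hSm (one_le_two)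
  have h2 : eLpNorm (sampleStep u α) 2 volume ≤ eLpNorm u 2 volume +
      eLpNorm (u - sampleStep u α) 2 volume := by
    simpa using eLpNorm_sub_le hum.aestronglyMeasurable (hum.aestronglyMeasurable.sub hSm)
      (one_le_two)
  rw [← lintegral_enorm_sampleStep_sq hα, ← sq_eLpNorm_two, ← sq_eLpNorm_two,
    ENNReal.ofReal_pow (by linarith), ENNReal.ofReal_pow (by linarith), ← mul_pow, ← mul_pow]
  constructor
  · gcongr
    rw [ENNReal.ofReal_sub _ hθ0, ENNReal.ofReal_one,
      ENNReal.sub_mul (fun _ _ => hu2.eLpNorm_lt_top.ne), one_mul, tsub_le_iff_left]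
    exact h1.trans (by gcongr)
  · gcongr
    rw [ENNReal.ofReal_add zero_le_one hθ0, ENNReal.ofReal_one, add_mul, one_mul]
    exact h2.trans (by gcongr)

/-! ### Periodizations of the transform of the window -/

theorem memLp_l2Fourier (φ : ℝ → ℝ) : MemLp (l2Fourier φ) 2 := Lp.memLp _

theorem measurable_l2Fourier (φ : ℝ → ℝ) : Measurable (l2Fourier φ) :=
  (Lp.stronglyMeasurable _).measurable

theorem fourierPeriodization_eq (φ : ℝ → ℝ) (β : ℝ) :
    fourierPeriodization φ β = periodization φ (1 / β) := by
  ext w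
  simp [fourierPeriodization, periodization, mul_comm]

theorem measurable_fourierPeriodization (φ : ℝ → ℝ) (β : ℝ) :
    Measurable (fourierPeriodization φ β) := by
  have := measurable_l2Fourier φ
  unfold fourierPeriodization
  fun_prop

section Unfolding

variable {β : ℝ}

/-- Unfolding of a weighted integral of `|φ̂|²` against a `β`-periodic weight. -/
theorem lintegral_mul_sq_l2Fourier (φ : ℝ → ℝ) (hβ : 0 < β) {W : ℝ → ℝ≥0∞} (hW : Measurable W)
    (hper : Function.Periodic W β) :
    ∫⁻ w, W w * ‖l2Fourier φ w‖ₑ ^ 2 =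
      ∫⁻ w in Set.Ioc 0 β, W w * fourierPeriodization φ β w := by
  have := measurable_l2Fourier φ
  rw [lintegral_eq_setLIntegral_tsum_Ioc hβ 0 (by fun_prop), zero_add]
  refine lintegral_congr fun w => ?_
  rw [fourierPeriodization, ← ENNReal.tsum_mul_left]
  refine tsum_congr fun j => ?_
  rw [hper.int_mul j w, mul_comm β]

theorem lintegral_mul_sq_mul_sq_l2Fourier (φ : ℝ → ℝ) (hβ : 0 < β) {W : ℝ → ℝ≥0∞}
    (hW : Measurable W) (hper : Function.Periodic W β) :
    ∫⁻ w, W w * (ENNReal.ofReal (w ^ 2) * ‖l2Fourier φ w‖ₑ ^ 2) =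
      ∫⁻ w in Set.Ioc 0 β, W w * momentPeriodization φ (1 / β) w := by
  have := measurable_l2Fourier φ
  rw [lintegral_eq_setLIntegral_tsum_Ioc hβ 0 (by fun_prop), zero_add]
  refine lintegral_congr fun w => ?_
  rw [momentPeriodization, ← ENNReal.tsum_mul_left]
  refine tsum_congr fun j => ?_
  rw [hper.int_mul j w, div_div_eq_mul_div, div_one]

end Unfolding

theorem ae_le_essSup_Ioc {g : ℝ → ℝ≥0∞} (T : ℝ) :
    ∀ᵐ w ∂volume.restrict (Set.Ioc 0 T), g w ≤ essSup g (volume.restrict (Set.Icc 0 T)) :=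
  ae_mono (Measure.restrict_mono Set.Ioc_subset_Icc_self le_rfl) (ENNReal.ae_le_essSup g)

/-! ### Integrability of `φ̂` and pointwise inversion -/

namespace ClassA

variable {φ : ℝ → ℝ} (hφ : ClassA φ)

include hφ

/-- The moment condition with `h = 1` bounds the periodized integrand on a period of length `1`. -/
theorem lintegral_sq_mul_sq_l2Fourier_lt_top :
    ∫⁻ w, ENNReal.ofReal (w ^ 2) * ‖l2Fourier φ w‖ₑ ^ 2 < ∞ := by
  have h := lintegral_mul_sq_mul_sq_l2Fourier φ (β := 1) one_pos (W := 1) measurable_one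
    (fun _ => rfl)
  simp only [Pi.one_apply, one_mul] at h
  rw [h, div_one]
  refine (lintegral_mono_ae (ae_le_essSup_Ioc 1)).trans_lt ?_
  rw [setLIntegral_const]
  have := hφ.moment 1 one_pos
  rw [div_one] at this
  exact ENNReal.mul_lt_top this (by simp)

theorem memLp_mul_l2Fourier : MemLp (fun w : ℝ => (w : ℂ) * l2Fourier φ w) 2 := by
  have := measurable_l2Fourier φ
  refine ⟨(by fun_prop : Measurable _).aestronglyMeasurable, ?_⟩
  refine (ENNReal.pow_lt_top_iff.1 ?_).resolve_right two_ne_zero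
  rw [sq_eLpNorm_two]
  convert hφ.lintegral_sq_mul_sq_l2Fourier_lt_top using 3 with w
  rw [enorm_mul, mul_pow]
  congr 1
  rw [← sq_abs, ENNReal.ofReal_pow (abs_nonneg _), ← ofReal_norm, Complex.norm_real,
    Real.norm_eq_abs]

theorem integrable_l2Fourier : Integrable (l2Fourier φ) := by
  have h1 := (memLp_two_iff_integrable_sq_norm (memLp_l2Fourier φ).1).1 (memLp_l2Fourier φ)
  have h2 := (memLp_two_iff_integrable_sq_norm hφ.memLp_mul_l2Fourier.1).1 hφ.memLp_mul_l2Fourier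
  refine ((integrable_inv_one_add_sq.add (h1.add h2))).mono' (memLp_l2Fourier φ).1
    (ae_of_all _ fun w => ?_)
  simp only [Pi.add_apply, norm_mul, mul_pow, Complex.norm_real, Real.norm_eq_abs, sq_abs]
  set r := ‖l2Fourier φ w‖
  have hpos : 0 < 1 + w ^ 2 := by positivity
  have : (1 + w ^ 2)⁻¹ + (r ^ 2 + w ^ 2 * r ^ 2) - 2 * r =
      (1 + w ^ 2)⁻¹ * (1 - (1 + w ^ 2) * r) ^ 2 := by
    field_simp
    ring
  have h3 : 0 ≤ (1 + w ^ 2)⁻¹ * (1 - (1 + w ^ 2) * r) ^ 2 := by positivity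
  have : 0 ≤ r := norm_nonneg _
  linarith

/-- Inversion in `L²` holds almost everywhere, and continuity of both sides upgrades it to every
point, as sampling requires. -/
theorem fourierInv_l2Fourier (x : ℝ) : 𝓕⁻ (l2Fourier φ) x = φ x := by
  have h1 := coeFn_fourierInv_toLp hφ.integrable_l2Fourier (memLp_l2Fourier φ)
  have h2 : (𝓕⁻ ((memLp_l2Fourier φ).toLp _) : L2R) = hφ.memLp.toLp _ := by
    have : (memLp_l2Fourier φ).toLp _ = 𝓕 (toL2R fun x => (φ x : ℂ)) := Lp.toLp_coeFn _ _
    rw [this, FourierTransform.fourierInv_fourier_eq, toL2R, dif_pos hφ.memLp]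
  rw [h2] at h1
  have h3 : 𝓕⁻ (l2Fourier φ) =ᵐ[volume] fun x => (φ x : ℂ) := h1.symm.trans hφ.memLp.coeFn_toLp
  exact congrFun (Continuous.ae_eq_iff_eq volume
    (continuous_fourierInv_of_integrable hφ.integrable_l2Fourier)
    (Complex.continuous_ofReal.comp hφ.continuous) |>.1 h3) x

end ClassA

/-! ### Finite combinations of translates on the frequency side -/

/-- The trigonometric polynomial `∑ d j exp (-2 π i j w / β)` on the circle. -/
noncomputable def circlePoly (β : ℝ) (s : Finset ℤ) (d : ℤ → ℂ) : C(AddCircle β, ℂ) :=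
  ∑ j ∈ s, d j • fourier (-j)

/-- The trigonometric polynomial `∑ d j exp (-2 π i j w / β)` on the line. -/
noncomputable def trigPoly (β : ℝ) (s : Finset ℤ) (d : ℤ → ℂ) (w : ℝ) : ℂ :=
  ∑ j ∈ s, d j * fourier (-j) (w : AddCircle β)

theorem circlePoly_coe (β : ℝ) (s : Finset ℤ) (d : ℤ → ℂ) (w : ℝ) :
    circlePoly β s d (w : AddCircle β) = trigPoly β s d w := by
  simp [circlePoly, trigPoly]

/-- The finite linear combination `∑ d j φ(· - h j)`. -/
noncomputable def shiftComb (φ : ℝ → ℝ) (h : ℝ) (s : Finset ℤ) (d : ℤ → ℂ) (y : ℝ) : ℂ :=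
  ∑ j ∈ s, d j * (φ (y - h * j) : ℂ)

@[fun_prop]
theorem continuous_trigPoly (β : ℝ) (s : Finset ℤ) (d : ℤ → ℂ) : Continuous (trigPoly β s d) := by
  unfold trigPoly
  refine continuous_finsetSum _ fun j _ => continuous_const.mul ?_
  exact (map_continuous (fourier (-j))).comp (AddCircle.continuous_mk' β)

theorem periodic_trigPoly (β : ℝ) (s : Finset ℤ) (d : ℤ → ℂ) :
    Function.Periodic (trigPoly β s d) β := fun w => by
  simp [trigPoly]

theorem periodic_sq_trigPoly (β : ℝ) (s : Finset ℤ) (d : ℤ → ℂ) :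
    Function.Periodic (fun w => ‖trigPoly β s d w‖ₑ ^ 2) β := fun w => by
  simp only [periodic_trigPoly β s d w]

theorem norm_trigPoly_le (β : ℝ) (s : Finset ℤ) (d : ℤ → ℂ) (w : ℝ) :
    ‖trigPoly β s d w‖ ≤ ∑ j ∈ s, ‖d j‖ := by
  refine (norm_sum_le _ _).trans (Finset.sum_le_sum fun j _ => ?_)
  rw [norm_mul, fourier_apply, Circle.norm_coe, mul_one]

theorem lintegral_sq_trigPoly {β : ℝ} (hβ : 0 < β) (s : Finset ℤ) (d : ℤ → ℂ) :
    ∫⁻ w in Set.Ioc 0 β, ‖trigPoly β s d w‖ₑ ^ 2 = ENNReal.ofReal β * ∑ j ∈ s, ‖d j‖ₑ ^ 2 := by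
  have : Fact (0 < β) := ⟨hβ⟩
  have hlin : ∫⁻ w in Set.Ioc 0 β, ‖trigPoly β s d w‖ₑ ^ 2 =
      ∫⁻ z : AddCircle β, ‖circlePoly β s d z‖ₑ ^ 2 := by
    rw [← AddCircle.lintegral_preimage β 0, zero_add]
    simp_rw [circlePoly_coe]
  have hnorm : ∫⁻ z : AddCircle β, ‖circlePoly β s d z‖ₑ ^ 2 ∂AddCircle.haarAddCircle =
      ∑ j ∈ s, ‖d j‖ₑ ^ 2 := by
    set F : Lp ℂ 2 (@AddCircle.haarAddCircle β _) :=
      ContinuousMap.toLp 2 AddCircle.haarAddCircle ℂ (circlePoly β s d)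
    have h1 : F = ∑ j ∈ s, d j • fourierLp (T := β) 2 (-j) := by
      simp [F, circlePoly, fourierLp]
    have h2 : ‖F‖ ^ 2 = ∑ j ∈ s, ‖d j‖ ^ 2 := by
      have ho : Orthonormal ℂ fun j : ℤ => fourierLp (T := β) 2 (-j) :=
        orthonormal_fourier.comp _ neg_injective
      rw [← inner_self_eq_norm_sq (𝕜 := ℂ), h1, ho.inner_sum]
      simp [← Complex.normSq_eq_conj_mul_self, Complex.normSq_eq_norm_sq, -Complex.ofReal_pow]
    have h3 : ‖F‖ₑ ^ 2 =
        ∫⁻ z : AddCircle β, ‖circlePoly β s d z‖ₑ ^ 2 ∂AddCircle.haarAddCircle := by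
      rw [Lp.enorm_def, sq_eLpNorm_two]
      refine lintegral_congr_ae ?_
      filter_upwards [ContinuousMap.coeFn_toLp (p := 2) (𝕜 := ℂ) AddCircle.haarAddCircle
        (circlePoly β s d)] with z hz
      rw [hz]
    rw [← h3, ← ofReal_norm, ← ENNReal.ofReal_pow (norm_nonneg _), h2,
      ENNReal.ofReal_sum_of_nonneg fun _ _ => by positivity]
    simp [ENNReal.ofReal_pow]
  rw [hlin, AddCircle.volume_eq_smul_haarAddCircle, lintegral_smul_measure, hnorm, smul_eq_mul]

theorem MeasureTheory.MemLp.trigPoly_mul {g : ℝ → ℂ} (hg : MemLp g 2) (β : ℝ) (s : Finset ℤ)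
    (d : ℤ → ℂ) :
    MemLp (fun w => trigPoly β s d w * g w) 2 := by
  refine MemLp.of_le_mul hg ((continuous_trigPoly β s d).aestronglyMeasurable.mul hg.1)
    (c := ∑ j ∈ s, ‖d j‖) (ae_of_all _ fun w => ?_)
  rw [norm_mul]
  gcongr
  exact norm_trigPoly_le β s d w

theorem sq_enorm_toLp {g : ℝ → ℂ} (hg : MemLp g 2) :
    ‖hg.toLp g‖ₑ ^ 2 = ∫⁻ x, ‖g x‖ₑ ^ 2 := by
  rw [Lp.enorm_toLp, sq_eLpNorm_two]

namespace ClassA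

variable {φ : ℝ → ℝ} (hφ : ClassA φ)

include hφ

theorem integrable_trigPoly_mul (β : ℝ) (s : Finset ℤ) (d : ℤ → ℂ) :
    Integrable fun w => trigPoly β s d w * l2Fourier φ w :=
  hφ.integrable_l2Fourier.bdd_mul (continuous_trigPoly β s d).aestronglyMeasurable
    (ae_of_all _ (norm_trigPoly_le β s d))

/-- Translation by `j/β` multiplies the transform by `exp (-2πi j w / β)`. -/
theorem shiftComb_eq_fourierInv (β : ℝ) (s : Finset ℤ) (d : ℤ → ℂ) :
    shiftComb φ (1 / β) s d = 𝓕⁻ fun w => trigPoly β s d w * l2Fourier φ w := by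
  ext y
  have hint : ∀ z : ℝ, Integrable fun w : ℝ =>
      Complex.exp (↑(2 * Real.pi * inner ℝ w z) * Complex.I) • l2Fourier φ w := fun z =>
    hφ.integrable_l2Fourier.norm.mono' (by have := measurable_l2Fourier φ; fun_prop)
      (ae_of_all _ fun w => by rw [norm_smul, Complex.norm_exp_ofReal_mul_I, one_mul])
  have hterm : ∀ j : ℤ, (φ (y - 1 / β * j) : ℂ) = ∫ w : ℝ,
      Complex.exp (↑(2 * Real.pi * inner ℝ w (y - 1 / β * j)) * Complex.I) • l2Fourier φ w :=
    fun j => by rw [← hφ.fourierInv_l2Fourier, Real.fourierInv_eq']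
  rw [shiftComb, Real.fourierInv_eq']
  simp_rw [hterm, ← integral_const_mul]
  rw [← integral_finsetSum _ fun j _ => (hint _).const_mul (d j)]
  refine integral_congr_ae (ae_of_all _ fun w => ?_)
  simp only [trigPoly, smul_eq_mul, Finset.sum_mul, Finset.mul_sum]
  refine Finset.sum_congr rfl fun j _ => ?_
  have hexp : Complex.exp (↑(2 * Real.pi * inner ℝ w (y - 1 / β * j)) * Complex.I) =
      Complex.exp (↑(2 * Real.pi * inner ℝ w y) * Complex.I) *
        fourier (-j) (w : AddCircle β) := by
    rw [fourier_coe_apply, ← Complex.exp_add]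
    congr 1
    simp
    ring
  rw [hexp]
  ring

theorem memLp_shiftComb (β : ℝ) (s : Finset ℤ) (d : ℤ → ℂ) :
    MemLp (shiftComb φ (1 / β) s d) 2 := by
  rw [hφ.shiftComb_eq_fourierInv]
  exact (Lp.memLp _).ae_eq (coeFn_fourierInv_toLp (hφ.integrable_trigPoly_mul β s d)
    ((memLp_l2Fourier φ).trigPoly_mul β s d))

theorem continuous_shiftComb (β : ℝ) (s : Finset ℤ) (d : ℤ → ℂ) :
    Continuous (shiftComb φ (1 / β) s d) := by
  rw [hφ.shiftComb_eq_fourierInv]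
  exact continuous_fourierInv_of_integrable (hφ.integrable_trigPoly_mul β s d)

/-- Plancherel, followed by unfolding against the periodic weight `|D|²`. -/
theorem lintegral_sq_shiftComb {β : ℝ} (hβ : 0 < β) (s : Finset ℤ) (d : ℤ → ℂ) :
    ∫⁻ y, ‖shiftComb φ (1 / β) s d y‖ₑ ^ 2 =
      ∫⁻ w in Set.Ioc 0 β, ‖trigPoly β s d w‖ₑ ^ 2 * fourierPeriodization φ β w := by
  have hm := (memLp_l2Fourier φ).trigPoly_mul β s d
  rw [← lintegral_mul_sq_l2Fourier φ hβ (by fun_prop) (periodic_sq_trigPoly β s d)]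
  simp_rw [← mul_pow, ← enorm_mul]
  rw [← sq_enorm_toLp hm, ← sq_enorm_toLp (hφ.memLp_shiftComb β s d)]
  have : (hφ.memLp_shiftComb β s d).toLp _ = 𝓕⁻ (hm.toLp _) := by
    refine Lp.ext ?_
    refine (MemLp.coeFn_toLp _).trans ?_
    rw [hφ.shiftComb_eq_fourierInv]
    exact (coeFn_fourierInv_toLp (hφ.integrable_trigPoly_mul β s d) hm).symm
  rw [this]
  congr 1
  rw [← ofReal_norm, ← ofReal_norm, ← Lp.norm_fourier_eq, FourierTransform.fourier_fourierInv_eq]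

/-- A combination of translates has an `L²` derivative. -/
theorem exists_weak_deriv_shiftComb {β : ℝ} (hβ : 0 < β) (s : Finset ℤ) (d : ℤ → ℂ) :
    ∃ v : ℝ → ℂ, Measurable v ∧
      (∀ a b, a ≤ b → ‖shiftComb φ (1 / β) s d b - shiftComb φ (1 / β) s d a‖ₑ ≤
        ∫⁻ x in Set.Ioc a b, ‖v x‖ₑ) ∧
      ∫⁻ x, ‖v x‖ₑ ^ 2 = ENNReal.ofReal ((2 * Real.pi) ^ 2) *
        ∫⁻ w in Set.Ioc 0 β, ‖trigPoly β s d w‖ₑ ^ 2 * momentPeriodization φ (1 / β) w := by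
  have hm : MemLp (fun w : ℝ => 2 * Real.pi * Complex.I * w *
      (trigPoly β s d w * l2Fourier φ w)) 2 := by
    convert! (hφ.memLp_mul_l2Fourier.trigPoly_mul β s d).const_mul (2 * Real.pi * Complex.I) using 2
    ring
  refine ⟨(𝓕⁻ (hm.toLp _) : L2R), (Lp.stronglyMeasurable _).measurable, fun a b hab => ?_, ?_⟩
  · rw [hφ.shiftComb_eq_fourierInv,
      setIntegral_fourierInv_eq (hφ.integrable_trigPoly_mul β s d) hm hab]
    exact enorm_integral_le_lintegral_enorm _
  · rw [← sq_eLpNorm_two, ← Lp.enorm_def, ← ofReal_norm, ← Lp.norm_fourier_eq,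
      FourierTransform.fourier_fourierInv_eq, ofReal_norm, sq_enorm_toLp hm,
      ← lintegral_mul_sq_mul_sq_l2Fourier φ hβ (by fun_prop) (periodic_sq_trigPoly β s d),
      ← lintegral_const_mul']
    · refine lintegral_congr fun w => ?_
      have h2 : ENNReal.ofReal ((2 * Real.pi) ^ 2) * ENNReal.ofReal (w ^ 2) =
          ‖(2 * Real.pi * Complex.I * w : ℂ)‖ₑ ^ 2 := by
        rw [← ENNReal.ofReal_mul (by positivity), ← ofReal_norm,
          ← ENNReal.ofReal_pow (norm_nonneg _)]
        congr 1
        simp [mul_pow]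
      rw [enorm_mul, mul_pow, ← h2, enorm_mul, mul_pow]
      ring
    · exact ENNReal.ofReal_ne_top

end ClassA

/-! ### Comparison of measures by trigonometric polynomials -/

theorem exists_circlePoly_of_mem_span {β : ℝ} {F : C(AddCircle β, ℂ)}
    (hF : F ∈ Submodule.span ℂ (Set.range (@fourier β))) : ∃ s d, F = circlePoly β s d := by
  have hr : Set.range (@fourier β) = Set.range fun j : ℤ => @fourier β (-j) :=
    (neg_surjective.range_comp (@fourier β)).symm
  rw [hr, Finsupp.mem_span_range_iff_exists_finsupp] at hF
  obtain ⟨c, rfl⟩ := hF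
  exact ⟨c.support, c, rfl⟩

/-- Trigonometric polynomials are uniformly dense in the continuous functions, and for finite
measures the `L²` norms are continuous in the uniform norm. -/
theorem eLpNorm_le_of_circlePoly {β : ℝ} [Fact (0 < β)] {μ ν : Measure (AddCircle β)}
    [IsFiniteMeasure μ] [IsFiniteMeasure ν]
    (h : ∀ s d, ∫⁻ z, ‖circlePoly β s d z‖ₑ ^ 2 ∂μ ≤ ∫⁻ z, ‖circlePoly β s d z‖ₑ ^ 2 ∂ν)
    (F : C(AddCircle β, ℂ)) : eLpNorm F 2 μ ≤ eLpNorm F 2 ν := by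
  have hcoe : ∀ (κ : Measure (AddCircle β)) [IsFiniteMeasure κ] (G : C(AddCircle β, ℂ)),
      ‖ContinuousMap.toLp 2 κ ℂ G‖ₑ = eLpNorm G 2 κ := fun κ _ G => by
    rw [Lp.enorm_def]
    exact eLpNorm_congr_ae (ContinuousMap.coeFn_toLp κ G)
  have hclosed : IsClosed {G : C(AddCircle β, ℂ) |
      ‖ContinuousMap.toLp 2 μ ℂ G‖ₑ ≤ ‖ContinuousMap.toLp 2 ν ℂ G‖ₑ} :=
    isClosed_le (by fun_prop) (by fun_prop)
  have hsub : (Submodule.span ℂ (Set.range (@fourier β)) : Set C(AddCircle β, ℂ)) ⊆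
      {G | ‖ContinuousMap.toLp 2 μ ℂ G‖ₑ ≤ ‖ContinuousMap.toLp 2 ν ℂ G‖ₑ} := by
    intro G hG
    obtain ⟨s, d, rfl⟩ := exists_circlePoly_of_mem_span hG
    rw [Set.mem_ofPred_eq, hcoe, hcoe, ← ENNReal.pow_le_pow_left_iff two_ne_zero, sq_eLpNorm_two,
      sq_eLpNorm_two]
    exact h s d
  have hF : F ∈ closure (Submodule.span ℂ (Set.range (@fourier β)) : Set C(AddCircle β, ℂ)) := by
    rw [← Submodule.topologicalClosure_coe, span_fourier_closure_eq_top]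
    trivial
  have := closure_minimal hsub hclosed hF
  rwa [Set.mem_ofPred_eq, hcoe, hcoe] at this

/-- A continuous approximation of an indicator in `L²(μ + ν)` is good for both measures at once. -/
theorem measure_le_of_circlePoly {β : ℝ} [Fact (0 < β)] {μ ν : Measure (AddCircle β)}
    [IsFiniteMeasure μ] [IsFiniteMeasure ν]
    (h : ∀ s d, ∫⁻ z, ‖circlePoly β s d z‖ₑ ^ 2 ∂μ ≤ ∫⁻ z, ‖circlePoly β s d z‖ₑ ^ 2 ∂ν) :
    μ ≤ ν := by
  refine Measure.le_intro fun E hE _ => ?_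
  have hsq : ∀ κ : Measure (AddCircle β), κ E =
      eLpNorm (E.indicator (1 : AddCircle β → ℂ)) 2 κ ^ 2 :=
    fun κ => by
      rw [sq_eLpNorm_two, ← lintegral_indicator_one hE]
      refine lintegral_congr fun z => ?_
      by_cases hz : z ∈ E <;> simp [hz]
  rw [hsq, hsq]
  refine pow_le_pow_left' ?_ 2
  refine ENNReal.le_of_forall_pos_le_add fun ε hε _ => ?_
  have hm : MemLp (E.indicator (1 : AddCircle β → ℂ)) 2 (μ + ν) :=
    memLp_indicator_const 2 hE (1 : ℂ) (Or.inr (measure_ne_top _ _))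
  obtain ⟨g₀, hg, -⟩ := hm.exists_boundedContinuous_eLpNorm_sub_le (by norm_num)
    (ε := (ε / 2 : NNReal)) (by simpa using hε.ne')
  have hle := eLpNorm_le_of_circlePoly h g₀.toContinuousMap
  rw [BoundedContinuousFunction.coe_toContinuousMap] at hle
  have hgs : StronglyMeasurable (g₀ : AddCircle β → ℂ) := g₀.continuous.stronglyMeasurable
  set g : AddCircle β → ℂ := ⇑g₀
  set χ := E.indicator (1 : AddCircle β → ℂ)
  have hχ : StronglyMeasurable χ := stronglyMeasurable_one.indicator hE
  have hμ : eLpNorm (χ - g) 2 μ ≤ (ε / 2 : NNReal) :=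
    (eLpNorm_mono_measure _ (Measure.le_add_right le_rfl)).trans hg
  have hν : eLpNorm (χ - g) 2 ν ≤ (ε / 2 : NNReal) :=
    (eLpNorm_mono_measure _ (Measure.le_add_left le_rfl)).trans hg
  calc eLpNorm χ 2 μ = eLpNorm (g + (χ - g)) 2 μ := by simp
    _ ≤ eLpNorm g 2 μ + eLpNorm (χ - g) 2 μ :=
      eLpNorm_add_le hgs.aestronglyMeasurable (hχ.sub hgs).aestronglyMeasurable one_le_two
    _ ≤ eLpNorm g 2 ν + (ε / 2 : NNReal) :=
      add_le_add hle hμ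
    _ = eLpNorm (χ - (χ - g)) 2 ν + (ε / 2 : NNReal) := by simp
    _ ≤ eLpNorm χ 2 ν + eLpNorm (χ - g) 2 ν + (ε / 2 : NNReal) := by
      gcongr
      exact eLpNorm_sub_le hχ.aestronglyMeasurable (hχ.sub hgs).aestronglyMeasurable one_le_two
    _ ≤ eLpNorm χ 2 ν + (ε / 2 : NNReal) + (ε / 2 : NNReal) := by gcongr
    _ = eLpNorm χ 2 ν + ε := by rw [add_assoc, ← ENNReal.coe_add, add_halves]

/-- Comparison of two densities by means of trigonometric polynomials. -/
theorem ae_le_of_trigPoly {β : ℝ} (hβ : 0 < β) {p q : ℝ → ℝ≥0∞} (hp : Measurable p)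
    (hq : Measurable q) (hpf : ∫⁻ w in Set.Ioc 0 β, p w ≠ ∞) (hqf : ∫⁻ w in Set.Ioc 0 β, q w ≠ ∞)
    (h : ∀ s d, ∫⁻ w in Set.Ioc 0 β, ‖trigPoly β s d w‖ₑ ^ 2 * p w ≤
      ∫⁻ w in Set.Ioc 0 β, ‖trigPoly β s d w‖ₑ ^ 2 * q w) :
    ∀ᵐ w ∂volume.restrict (Set.Ioc 0 β), p w ≤ q w := by
  have : Fact (0 < β) := ⟨hβ⟩
  set κ := volume.restrict (Set.Ioc 0 β)
  have hcoe : Measurable ((↑) : ℝ → AddCircle β) := AddCircle.measurable_mk'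
  have hint : ∀ r : ℝ → ℝ≥0∞, Measurable r → ∀ s d,
      ∫⁻ z, ‖circlePoly β s d z‖ₑ ^ 2 ∂((κ.withDensity r).map (↑)) =
        ∫⁻ w in Set.Ioc 0 β, ‖trigPoly β s d w‖ₑ ^ 2 * r w := fun r hr s d => by
    rw [lintegral_map (by fun_prop) hcoe]
    simp_rw [circlePoly_coe]
    rw [lintegral_withDensity_eq_lintegral_mul _ hr (by fun_prop)]
    simp [mul_comm, κ]
  have := isFiniteMeasure_withDensity hpf
  have := isFiniteMeasure_withDensity hqf
  have hle : (κ.withDensity p).map ((↑) : ℝ → AddCircle β) ≤ (κ.withDensity q).map (↑) :=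
    measure_le_of_circlePoly fun s d => by
      rw [hint p hp, hint q hq]
      exact h s d
  -- A measurable section of the quotient map over `(0, β]` carries the inequality of measures from
  -- the circle back to the line.
  set r : AddCircle β → ℝ := fun z => (AddCircle.equivIoc β 0 z : ℝ)
  have hr : Measurable r :=
    measurable_subtype_coe.comp (AddCircle.measurableEquivIoc β 0).measurable
  have hid : ∀ f : ℝ → ℝ≥0∞, ((κ.withDensity f).map ((↑) : ℝ → AddCircle β)).map r =
      κ.withDensity f := fun f => by
    rw [Measure.map_map hr hcoe]
    refine (Measure.map_congr ?_).trans Measure.map_id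
    refine withDensity_absolutelyContinuous κ f ?_
    filter_upwards [ae_restrict_mem measurableSet_Ioc] with w hw
    have := AddCircle.equivIoc_coe_eq (p := β) (a := 0) (x := w) (by simpa using hw)
    simp [r, this]
  have hle2 : κ.withDensity p ≤ κ.withDensity q := by
    rw [← hid p, ← hid q]
    exact Measure.map_mono hle hr
  refine ae_le_of_forall_setLIntegral_le_of_sigmaFinite hp fun E hE _ => ?_
  rw [← withDensity_apply _ hE, ← withDensity_apply _ hE]
  exact hle2 E

/-! ### From the Riesz inequalities to bounds on the periodization -/

theorem eq_sum_of_hasSum_of_lp {f : L2R} {e : ℤ → L2R} {s : Finset ℤ} {d : lp (fun _ : ℤ => ℂ) 2}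
    (hd : ∀ k ∉ s, d k = 0) (hf : HasSum (fun k => d k • e k) f) : f = ∑ k ∈ s, d k • e k :=
  hf.unique (hasSum_sum_of_ne_finset_zero fun k hk => by rw [hd k hk, zero_smul])

theorem ClassA.coeFn_sum_shiftL2R {φ : ℝ → ℝ} (hφ : ClassA φ) (h : ℝ) (s : Finset ℤ) (d : ℤ → ℂ) :
    ((∑ k ∈ s, d k • shiftL2R φ h k : L2R) : ℝ → ℂ) =ᵐ[volume] shiftComb φ h s d := by
  have hk : ∀ k ∈ s, ((d k • shiftL2R φ h k : L2R) : ℝ → ℂ) =ᵐ[volume]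
      fun x => d k * (φ (x - h * k) : ℂ) := fun k _ => by
    have hm : MemLp (fun x => (φ (x - h * k) : ℂ)) 2 :=
      hφ.memLp.comp_measurePreserving (measurePreserving_sub_right volume (h * k))
    rw [shiftL2R, toL2R, dif_pos hm]
    filter_upwards [Lp.coeFn_smul (d k) (hm.toLp _), hm.coeFn_toLp] with x h1 h2
    rw [h1, Pi.smul_apply, h2, smul_eq_mul]
  have h1 := Lp.coeFn_finsetSum s fun k => d k • shiftL2R φ h k
  refine h1.trans ?_
  have h2 := (ae_ball_iff (s.countable_toSet)).2 hk
  filter_upwards [h2] with x hx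
  rw [Finset.sum_apply, shiftComb]
  exact Finset.sum_congr rfl hx

theorem ClassA.exists_riesz_bounds {φ : ℝ → ℝ} (hφ : ClassA φ) {β : ℝ}
    (hs : IsStableGenerator φ (1 / β)) :
    ∃ A B : ℝ, 0 < A ∧ 0 < B ∧ ∀ s d,
      ENNReal.ofReal A * ∑ j ∈ s, ‖d j‖ₑ ^ 2 ≤ ∫⁻ y, ‖shiftComb φ (1 / β) s d y‖ₑ ^ 2 ∧
      ∫⁻ y, ‖shiftComb φ (1 / β) s d y‖ₑ ^ 2 ≤ ENNReal.ofReal B * ∑ j ∈ s, ‖d j‖ₑ ^ 2 := by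
  obtain ⟨-, A, B, hA, hB, hAB⟩ := hs
  refine ⟨A, B, hA, hB, fun s d => ?_⟩
  set d' : ℤ → ℂ := fun j => if j ∈ s then d j else 0
  have hd'0 : ∀ k ∉ s, d' k = 0 := fun k hk => by simp [d', hk]
  have hmem : Memℓp (E := fun _ : ℤ => ℂ) d' 2 := by
    refine (memℓp_zero (E := fun _ : ℤ => ℂ) ?_).of_exponent_ge zero_le
    refine s.finite_toSet.subset fun k hk => ?_
    by_contra hks
    exact hk (hd'0 k hks)
  obtain ⟨f, hf, h1, h2⟩ := hAB ⟨d', hmem⟩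
  have hfe := eq_sum_of_hasSum_of_lp (s := s) (d := ⟨d', hmem⟩) hd'0 hf
  have hfe' : f = ∑ k ∈ s, d k • shiftL2R φ (1 / β) k := by
    rw [hfe]
    exact Finset.sum_congr rfl fun k hk => by simp [d', hk]
  have hnorm : ENNReal.ofReal (‖f‖ ^ 2) = ∫⁻ y, ‖shiftComb φ (1 / β) s d y‖ₑ ^ 2 := by
    rw [ENNReal.ofReal_pow (norm_nonneg _), ofReal_norm, Lp.enorm_def, sq_eLpNorm_two, hfe']
    refine lintegral_congr_ae ?_
    filter_upwards [hφ.coeFn_sum_shiftL2R (1 / β) s d] with x hx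
    rw [hx]
  have hsum : ENNReal.ofReal (∑' k, ‖d' k‖ ^ 2) = ∑ j ∈ s, ‖d j‖ₑ ^ 2 := by
    rw [tsum_eq_sum (s := s) fun k hk => by simp [hd'0 k hk],
      ENNReal.ofReal_sum_of_nonneg fun _ _ => by positivity]
    exact Finset.sum_congr rfl fun k hk => by
      simp [d', hk, ENNReal.ofReal_pow]
  rw [← hnorm, ← hsum, ← ENNReal.ofReal_mul hA.le, ← ENNReal.ofReal_mul hB.le]
  exact ⟨ENNReal.ofReal_le_ofReal h1, ENNReal.ofReal_le_ofReal h2⟩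

/-- Since `∫ |D|² = β ∑ |d j|²` over a period, the Riesz inequalities compare the periodization with
the constant densities `A/β` and `B/β`. -/
theorem ClassA.exists_periodization_bounds {φ : ℝ → ℝ} (hφ : ClassA φ) {β : ℝ} (hβ : 0 < β)
    (hs : IsStableGenerator φ (1 / β)) :
    ∃ a b : ℝ≥0∞, a ≠ 0 ∧ b ≠ ∞ ∧
      ∀ᵐ w ∂volume.restrict (Set.Ioc 0 β),
        a ≤ fourierPeriodization φ β w ∧ fourierPeriodization φ β w ≤ b := by
  obtain ⟨A, B, hA, hB, hAB⟩ := hφ.exists_riesz_bounds hs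
  have hβ0 : ENNReal.ofReal β ≠ 0 := (ENNReal.ofReal_pos.2 hβ).ne'
  have hconst : ∀ (C : ℝ) s d, ∫⁻ w in Set.Ioc 0 β,
      ‖trigPoly β s d w‖ₑ ^ 2 * (ENNReal.ofReal C / ENNReal.ofReal β) =
        ENNReal.ofReal C * ∑ j ∈ s, ‖d j‖ₑ ^ 2 := fun C s d => by
    rw [lintegral_mul_const _ (by fun_prop), lintegral_sq_trigPoly hβ, mul_comm, ← mul_assoc,
      ENNReal.div_mul_cancel hβ0 ENNReal.ofReal_ne_top]
  have hPm := measurable_fourierPeriodization φ β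
  have hcf : ∀ C : ℝ, ∫⁻ w in Set.Ioc 0 β, ENNReal.ofReal C / ENNReal.ofReal β ≠ ∞ := fun C => by
    rw [setLIntegral_const]
    exact ENNReal.mul_ne_top (ENNReal.div_ne_top ENNReal.ofReal_ne_top hβ0) (by simp)
  have hPf : ∫⁻ w in Set.Ioc 0 β, fourierPeriodization φ β w ≠ ∞ := by
    have h := lintegral_mul_sq_l2Fourier φ hβ (W := 1) measurable_one fun _ => rfl
    simp only [Pi.one_apply, one_mul] at h
    rw [← h, ← sq_eLpNorm_two]
    exact ENNReal.pow_ne_top (memLp_l2Fourier φ).eLpNorm_lt_top.ne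
  refine ⟨ENNReal.ofReal A / ENNReal.ofReal β, ENNReal.ofReal B / ENNReal.ofReal β,
    (ENNReal.div_pos (ENNReal.ofReal_pos.2 hA).ne' ENNReal.ofReal_ne_top).ne',
    ENNReal.div_ne_top ENNReal.ofReal_ne_top hβ0, ?_⟩
  refine (ae_le_of_trigPoly hβ measurable_const hPm (hcf A) hPf fun s d => ?_).and
    (ae_le_of_trigPoly hβ hPm measurable_const hPf (hcf B) fun s d => ?_)
  · rw [hconst, ← hφ.lintegral_sq_shiftComb hβ]
    exact (hAB s d).1
  · rw [hconst, ← hφ.lintegral_sq_shiftComb hβ]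
    exact (hAB s d).2

theorem restrict_Icc_eq_restrict_Ioc_volume (a b : ℝ) :
    (volume : Measure ℝ).restrict (Set.Icc a b) = volume.restrict (Set.Ioc a b) :=
  Measure.restrict_congr_set Ioc_ae_eq_Icc.symm

/-! ### Bernstein and sampling inequalities for combinations of translates -/

namespace ClassA

variable {φ : ℝ → ℝ} (hφ : ClassA φ) {β : ℝ} (hβ : 0 < β) (hs : IsStableGenerator φ (1 / β))

include hφ hβ hs

theorem essInf_fourierPeriodization_ne_zero :
    essInf (fourierPeriodization φ β) (volume.restrict (Set.Icc 0 β)) ≠ 0 := by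
  obtain ⟨a, b, ha, -, hab⟩ := hφ.exists_periodization_bounds hβ hs
  rw [← restrict_Icc_eq_restrict_Ioc_volume] at hab
  exact (lt_of_lt_of_le (pos_iff_ne_zero.2 ha)
    (le_essInf_of_ae_le a (hab.mono fun w hw => hw.1))).ne'

theorem essSup_fourierPeriodization_ne_top :
    essSup (fourierPeriodization φ β) (volume.restrict (Set.Icc 0 β)) ≠ ∞ := by
  obtain ⟨a, b, -, hb, hab⟩ := hφ.exists_periodization_bounds hβ hs
  rw [← restrict_Icc_eq_restrict_Ioc_volume] at hab
  exact ((essSup_le_of_ae_le b (hab.mono fun w hw => hw.2)).trans_lt hb.lt_top).ne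

theorem momentPeriodization_le :
    ∀ᵐ w ∂volume.restrict (Set.Ioc 0 β), momentPeriodization φ (1 / β) w ≤
      ENNReal.ofReal (bernsteinConst φ (1 / β)) * fourierPeriodization φ β w := by
  obtain ⟨a, b, ha, hb, hab⟩ := hφ.exists_periodization_bounds hβ hs
  have hmom := hφ.moment (1 / β) (by positivity)
  rw [one_div_one_div] at hmom
  -- `bernsteinConst` is a `toReal`, which would be `0` at infinity. The moment condition and the
  -- lower bound `a` on the denominator exclude this.
  have hM : essSup (bernsteinQuotient φ (1 / β)) (volume.restrict (Set.Icc 0 β)) ≠ ∞ := by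
    refine ne_top_of_le_ne_top (ENNReal.div_ne_top hmom.ne ha) (essSup_le_of_ae_le _ ?_)
    refine ae_mono (restrict_Icc_eq_restrict_Ioc_volume 0 β).le ?_
    filter_upwards [hab, ae_le_essSup_Ioc (g := momentPeriodization φ (1 / β)) β] with w h1 h2
    rw [bernsteinQuotient, ← fourierPeriodization_eq]
    exact ENNReal.div_le_div h2 h1.1
  rw [bernsteinConst, one_div_one_div, ENNReal.ofReal_toReal hM]
  filter_upwards [hab, ae_le_essSup_Ioc (g := bernsteinQuotient φ (1 / β)) β] with w h1 h2
  rw [bernsteinQuotient, ← fourierPeriodization_eq] at h2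
  rwa [ENNReal.div_le_iff (lt_of_lt_of_le (pos_iff_ne_zero.2 ha) h1.1).ne'
    (h1.2.trans_lt hb.lt_top).ne] at h2

theorem sampling_inequality_shiftComb {α : ℝ} (hα : 0 < α)
    (hθ : 2 * α * √(bernsteinConst φ (1 / β)) ≤ 1) (s : Finset ℤ) (d : ℤ → ℂ) (x : ℝ) :
    ENNReal.ofReal ((1 - 2 * α * √(bernsteinConst φ (1 / β))) ^ 2) *
        (essInf (fourierPeriodization φ β) (volume.restrict (Set.Icc 0 β)) *
          (ENNReal.ofReal β * ∑ j ∈ s, ‖d j‖ₑ ^ 2)) ≤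
      ENNReal.ofReal α * ∑' k : ℤ, ‖shiftComb φ (1 / β) s d (x - α * k)‖ₑ ^ 2 ∧
    ENNReal.ofReal α * ∑' k : ℤ, ‖shiftComb φ (1 / β) s d (x - α * k)‖ₑ ^ 2 ≤
      ENNReal.ofReal ((1 + 2 * α * √(bernsteinConst φ (1 / β))) ^ 2) *
        (essSup (fourierPeriodization φ β) (volume.restrict (Set.Icc 0 β)) *
          (ENNReal.ofReal β * ∑ j ∈ s, ‖d j‖ₑ ^ 2)) := by
  set M := bernsteinConst φ (1 / β)
  have hM0 : 0 ≤ M := ENNReal.toReal_nonneg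
  set θ := 2 * α * √M with hθdef
  obtain ⟨v, hvm, hv, hv2⟩ := hφ.exists_weak_deriv_shiftComb hβ s d
  have hG2 := hφ.lintegral_sq_shiftComb hβ s d
  have hGm := hφ.memLp_shiftComb β s d
  have hGc := hφ.continuous_shiftComb β s d
  set G := shiftComb φ (1 / β) s d
  have hPm := measurable_fourierPeriodization φ β
  have hI1 : ∫⁻ y, ‖G (x + y)‖ₑ ^ 2 = ∫⁻ y, ‖G y‖ₑ ^ 2 :=
    lintegral_add_left_eq_self (fun y => ‖G y‖ₑ ^ 2) x
  have hI2 : ∫⁻ y, ‖v (x + y)‖ₑ ^ 2 = ∫⁻ y, ‖v y‖ₑ ^ 2 :=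
    lintegral_add_left_eq_self (fun y => ‖v y‖ₑ ^ 2) x
  -- The Bernstein constant `2π√M` times the Wirtinger constant `α/π` is `θ = 2α√M`.
  have hbern : ENNReal.ofReal ((α / Real.pi) ^ 2) * ∫⁻ y, ‖v (x + y)‖ₑ ^ 2 ≤
      ENNReal.ofReal (θ ^ 2) * ∫⁻ y, ‖G (x + y)‖ₑ ^ 2 := by
    have h1 : ∫⁻ w in Set.Ioc 0 β, ‖trigPoly β s d w‖ₑ ^ 2 * momentPeriodization φ (1 / β) w ≤
        ENNReal.ofReal M *
          ∫⁻ w in Set.Ioc 0 β, ‖trigPoly β s d w‖ₑ ^ 2 * fourierPeriodization φ β w := by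
      rw [← lintegral_const_mul' _ _ ENNReal.ofReal_ne_top]
      refine lintegral_mono_ae ?_
      filter_upwards [hφ.momentPeriodization_le hβ hs] with w hw
      rw [mul_left_comm]
      gcongr
    rw [hI1, hI2, hv2, hG2, ← mul_assoc, ← ENNReal.ofReal_mul (by positivity)]
    refine (mul_le_mul_right h1 _).trans_eq ?_
    rw [← mul_assoc, ← ENNReal.ofReal_mul (by positivity)]
    congr 2
    have := Real.sq_sqrt hM0
    have hπ := Real.pi_ne_zero
    rw [hθdef, div_pow, mul_pow, mul_pow, this]
    field_simp
  have key := sampling_inequality (u := fun y => G (x + y)) (ρ := fun y => ‖v (x + y)‖ₑ)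
    (by fun_prop) (hGm.comp_measurePreserving (measurePreserving_add_left volume x)) (by fun_prop)
    (fun a b hab => ?_) hα (by positivity) hθ hbern
  · have hneg : ∑' k : ℤ, ‖G (x + α * k)‖ₑ ^ 2 = ∑' k : ℤ, ‖G (x - α * k)‖ₑ ^ 2 := by
      rw [← (Equiv.neg ℤ).tsum_eq]
      simp [sub_eq_add_neg]
    rw [hI1, hG2, hneg] at key
    refine ⟨le_trans ?_ key.1, key.2.trans ?_⟩
    · gcongr
      rw [← lintegral_sq_trigPoly hβ, ← lintegral_const_mul _ (by fun_prop)]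
      refine lintegral_mono_ae ?_
      rw [← restrict_Icc_eq_restrict_Ioc_volume]
      filter_upwards [ae_essInf_le (f := fourierPeriodization φ β)
        (μ := volume.restrict (Set.Icc 0 β))] with w hw
      rw [mul_comm]
      gcongr
    · gcongr
      rw [← lintegral_sq_trigPoly hβ, ← lintegral_const_mul _ (by fun_prop)]
      refine lintegral_mono_ae ?_
      filter_upwards [ae_le_essSup_Ioc (g := fourierPeriodization φ β) β] with w hw
      rw [mul_comm]
      gcongr
  · refine (hv (x + a) (x + b) (by linarith)).trans_eq ?_
    rw [← (measurePreserving_add_left volume x).setLIntegral_comp_preimage_emb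
      (measurableEmbedding_addLeft x)]
    simp

end ClassA

/-! ### Parseval and the fibres of the frame sum -/

theorem HasCompactSupport.exists_finset_translates {E : Type*} [Zero E] {f : ℝ → E}
    (hf : HasCompactSupport f) {h : ℝ} (hh : 0 < h) :
    ∃ s : Finset ℤ, ∀ x ∈ Set.Ioc 0 h, ∀ j ∉ s, f (x - h * j) = 0 := by
  obtain ⟨R, hR, hfR⟩ := hf.exists_pos_le_norm
  -- The extra `1` absorbs `x ≤ h`, so that `|x - h j| ≥ R` outside this range.
  refine ⟨Finset.Icc (-⌈R / h + 1⌉) ⌈R / h + 1⌉, fun x hx j hj => hfR _ ?_⟩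
  rw [Finset.mem_Icc, not_and_or, not_le, not_le] at hj
  have hc := Int.le_ceil (R / h + 1)
  have hR' : R = h * (R / h) := by field_simp
  rw [Real.norm_eq_abs]
  rcases hj with hj | hj
  · have hj' : (j : ℝ) < -⌈R / h + 1⌉ := by exact_mod_cast hj
    have h1 : h * (j : ℝ) ≤ h * (-(R / h + 1)) := by gcongr; linarith
    refine le_trans ?_ (le_abs_self _)
    linarith [hx.1]
  · have hj' : (⌈R / h + 1⌉ : ℝ) < j := by exact_mod_cast hj
    have h1 : h * (R / h + 1) ≤ h * (j : ℝ) := by gcongr; linarith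
    refine le_trans ?_ (neg_le_abs _)
    linarith [hx.2]

theorem lintegral_eq_setLIntegral_sum {h : ℝ} (hh : 0 < h) {g : ℝ → ℝ≥0∞} (hg : Measurable g)
    {s : Finset ℤ} (hs : ∀ x ∈ Set.Ioc 0 h, ∀ j ∉ s, g (x - h * j) = 0) :
    ∫⁻ x, g x = ∫⁻ x in Set.Ioc 0 h, ∑ j ∈ s, g (x - h * j) := by
  rw [lintegral_eq_setLIntegral_tsum_Ioc hh 0 hg, zero_add]
  refine setLIntegral_congr_fun measurableSet_Ioc fun x hx => ?_
  rw [← (Equiv.neg ℤ).tsum_eq, ← tsum_eq_sum (L := .unconditional ℤ) (hs x hx)]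
  exact tsum_congr fun j => by simp [sub_eq_add_neg, mul_comm]

theorem integral_eq_setIntegral_sum {h : ℝ} (hh : 0 < h) {g : ℝ → ℂ} (hg : Integrable g)
    {s : Finset ℤ} (hs : ∀ x ∈ Set.Ioc 0 h, ∀ j ∉ s, g (x - h * j) = 0) :
    ∫ x, g x = ∫ x in Set.Ioc 0 h, ∑ j ∈ s, g (x - h * j) := by
  have hU := hasSum_integral_iUnion (μ := volume) (f := g)
    (s := fun n : ℤ => Set.Ioc (0 + n • h) (0 + (n + 1) • h))
    (fun _ => measurableSet_Ioc) (Set.pairwise_disjoint_Ioc_add_zsmul 0 h) hg.integrableOn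
  rw [iUnion_Ioc_add_zsmul hh, setIntegral_univ] at hU
  have hpiece : ∀ n : ℤ, ∫ x in Set.Ioc (0 + n • h) (0 + (n + 1) • h), g x =
      ∫ x in Set.Ioc 0 h, g (x - h * (-n : ℤ)) := fun n => by
    rw [← (measurePreserving_sub_right volume (h * (-n : ℤ))).setIntegral_preimage_emb
      (MeasurableEquiv.subRight _).measurableEmbedding]
    congr 2
    ext x
    simp only [zsmul_eq_mul, Set.mem_preimage, Set.mem_Ioc, Int.cast_add, Int.cast_one,
      Int.cast_neg]
    constructor <;> rintro ⟨h1, h2⟩ <;> constructor <;> linarith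
  simp_rw [hpiece] at hU
  have hU' : HasSum (fun n : ℤ => ∫ x in Set.Ioc 0 h, g (x - h * n)) (∫ x, g x) :=
    (Equiv.neg ℤ).hasSum_iff.1 hU
  rw [integral_finsetSum s fun (j : ℤ) _ => (hg.comp_sub_right (h * j)).integrableOn]
  refine hU'.unique (hasSum_sum_of_ne_finset_zero fun j hj => ?_)
  rw [setIntegral_congr_fun measurableSet_Ioc fun x hx => hs x hx j hj]
  simp

/-- Parseval's identity for the periodization of a compactly supported function. -/
theorem tsum_sq_integral_exp_mul {h : ℝ} (hh : 0 < h) {ψ : ℝ → ℂ} (hc : Continuous ψ)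
    (hψ : HasCompactSupport ψ) {s : Finset ℤ}
    (hs : ∀ x ∈ Set.Ioc 0 h, ∀ j ∉ s, ψ (x - h * j) = 0) :
    ∑' m : ℤ, ‖∫ x : ℝ, Complex.exp (-(2 * Real.pi * Complex.I * m * x / h)) * ψ x‖ₑ ^ 2 =
      ENNReal.ofReal h * ∫⁻ x in Set.Ioc 0 h, ‖∑ j ∈ s, ψ (x - h * j)‖ₑ ^ 2 := by
  set F : ℝ → ℂ := fun x => ∑ j ∈ s, ψ (x - h * j)
  have hFc : Continuous F := by fun_prop
  have hFi : IntegrableOn (fun x => ‖F x‖ ^ 2) (Set.Ioc 0 h) :=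
    (Continuous.integrableOn_Icc (by fun_prop)).mono_set Set.Ioc_subset_Icc_self
  have hF2 : MemLp F 2 (volume.restrict (Set.Ioc 0 h)) :=
    (memLp_two_iff_integrable_sq_norm hFc.aestronglyMeasurable).2 hFi
  -- The exponentials have period `h`, so an integral over the line is `h` times a Fourier
  -- coefficient of the sum of translates.
  have hper : ∀ (m j : ℤ) (x : ℝ),
      Complex.exp (-(2 * Real.pi * Complex.I * m * (x - h * j : ℝ) / h)) =
        Complex.exp (-(2 * Real.pi * Complex.I * m * x / h)) := fun m j x => by
    have hh' : (h : ℂ) ≠ 0 := by exact_mod_cast hh.ne'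
    rw [← Complex.exp_periodic.int_mul (-(m * j))]
    congr 1
    push_cast
    field_simp
    ring
  set c : ℤ → ℂ := fun m =>
    ∫ x : ℝ, Complex.exp (-(2 * Real.pi * Complex.I * m * x / h)) * ψ x
  have hcoef : ∀ m, fourierCoeffOn hh F m = (h⁻¹ : ℝ) • c m := fun m => by
    have hi : Integrable fun x : ℝ =>
        Complex.exp (-(2 * Real.pi * Complex.I * m * x / h)) * ψ x :=
      Continuous.integrable_of_hasCompactSupport (by fun_prop) hψ.mul_left
    rw [fourierCoeffOn_eq_integral, intervalIntegral.integral_of_le hh.le, sub_zero, one_div]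
    simp only [c]
    rw [integral_eq_setIntegral_sum hh hi fun x hx j hj => by simp [hs x hx j hj]]
    congr 1
    refine integral_congr_ae (ae_of_all _ fun x => ?_)
    simp only [hper, ← Finset.mul_sum]
    rw [fourier_coe_apply, smul_eq_mul]
    congr 2
    push_cast
    ring
  have hsum := hasSum_sq_fourierCoeffOn hh hF2
  have hterm : ∀ m, ‖c m‖ₑ ^ 2 =
      ENNReal.ofReal (h ^ 2) * ENNReal.ofReal (‖fourierCoeffOn hh F m‖ ^ 2) := fun m => by
    rw [← ofReal_norm, ← ENNReal.ofReal_pow (norm_nonneg _), ← ENNReal.ofReal_mul (by positivity),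
      hcoef, norm_smul, norm_inv, Real.norm_of_nonneg hh.le]
    congr 1
    field_simp
  have hint : ENNReal.ofReal (∫ x in (0)..h, ‖F x‖ ^ 2) = ∫⁻ x in Set.Ioc 0 h, ‖F x‖ₑ ^ 2 := by
    rw [intervalIntegral.integral_of_le hh.le,
      ofReal_integral_eq_lintegral_ofReal hFi (ae_of_all _ fun x => by positivity)]
    simp [ENNReal.ofReal_pow]
  change ∑' m, ‖c m‖ₑ ^ 2 = _
  rw [tsum_congr hterm, ENNReal.tsum_mul_left,
    ← ENNReal.ofReal_tsum_of_nonneg (fun m => by positivity) hsum.summable,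
    hsum.tsum_eq, ← hint, ← ENNReal.ofReal_mul (by positivity), ← ENNReal.ofReal_mul hh.le]
  congr 1
  rw [sub_zero, smul_eq_mul]
  field_simp

theorem ClassA.memLp_gabor {φ : ℝ → ℝ} (hφ : ClassA φ) (α β : ℝ) (p : ℤ × ℤ) :
    MemLp (fun x : ℝ => Complex.exp (2 * Real.pi * Complex.I * β * p.2 * x) *
      (φ (x - α * p.1) : ℂ)) 2 := by
  have hm : MemLp (fun x => (φ (x - α * p.1) : ℂ)) 2 :=
    hφ.memLp.comp_measurePreserving (measurePreserving_sub_right volume (α * p.1))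
  refine hm.of_le ((by fun_prop : Continuous _).aestronglyMeasurable.mul hm.1)
    (ae_of_all _ fun x => ?_)
  rw [norm_mul, show 2 * (Real.pi : ℂ) * Complex.I * β * p.2 * x =
    ((2 * Real.pi * β * p.2 * x : ℝ) : ℂ) * Complex.I by push_cast; ring,
    Complex.norm_exp_ofReal_mul_I, one_mul]

theorem ClassA.inner_gaborSystem {φ : ℝ → ℝ} (hφ : ClassA φ) (α β : ℝ) (p : ℤ × ℤ) {f : ℝ → ℂ}
    (hf : MemLp f 2) :
    inner ℂ (gaborSystem φ α β p) (hf.toLp f) =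
      ∫ x : ℝ, Complex.exp (-(2 * Real.pi * Complex.I * p.2 * x / (1 / β : ℝ))) *
        (f x * (φ (x - α * p.1) : ℂ)) := by
  rw [gaborSystem, toL2R, dif_pos (hφ.memLp_gabor α β p), L2.inner_def]
  refine integral_congr_ae ?_
  filter_upwards [(hφ.memLp_gabor α β p).coeFn_toLp, hf.coeFn_toLp] with x h1 h2
  rw [h1, h2]
  have h3 : (starRingEnd ℂ) (Complex.exp (2 * Real.pi * Complex.I * β * p.2 * x)) =
      Complex.exp (-(2 * Real.pi * Complex.I * p.2 * x / (1 / β : ℝ))) := by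
    rw [← Complex.exp_conj]
    congr 1
    simp [map_ofNat]
    ring
  simp only [RCLike.inner_apply, map_mul, h3, Complex.conj_ofReal]
  ring

/-- The frame sum as an integral over the fibres `x + h ℤ`, with `h = 1 / β`. -/
theorem ClassA.tsum_sq_inner_gaborSystem {φ : ℝ → ℝ} (hφ : ClassA φ) (α : ℝ) {β : ℝ} (hβ : 0 < β)
    {f : ℝ → ℂ} (hf : MemLp f 2) (hfc : Continuous f) (hfs : HasCompactSupport f) {s : Finset ℤ}
    (hs : ∀ x ∈ Set.Ioc 0 (1 / β), ∀ j ∉ s, f (x - 1 / β * j) = 0) :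
    ∑' p : ℤ × ℤ, ‖inner ℂ (gaborSystem φ α β p) (hf.toLp f)‖ₑ ^ 2 =
      ENNReal.ofReal (1 / β) * ∫⁻ x in Set.Ioc 0 (1 / β), ∑' k : ℤ,
        ‖shiftComb φ (1 / β) s (fun j => f (x - 1 / β * j)) (x - α * k)‖ₑ ^ 2 := by
  have hφc := hφ.continuous
  simp_rw [hφ.inner_gaborSystem α β _ hf]
  rw [ENNReal.tsum_prod']
  have hk : ∀ k : ℤ, ∑' m : ℤ, ‖∫ x : ℝ, Complex.exp
      (-(2 * Real.pi * Complex.I * m * x / (1 / β : ℝ))) * (f x * (φ (x - α * k) : ℂ))‖ₑ ^ 2 =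
      ENNReal.ofReal (1 / β) * ∫⁻ x in Set.Ioc 0 (1 / β),
        ‖shiftComb φ (1 / β) s (fun j => f (x - 1 / β * j)) (x - α * k)‖ₑ ^ 2 := fun k => by
    rw [tsum_sq_integral_exp_mul (s := s) (ψ := fun x => f x * (φ (x - α * k) : ℂ))
      (by positivity) (by fun_prop) hfs.mul_right
      fun x hx j hj => by simp only [hs x hx j hj, zero_mul]]
    simp only [shiftComb, sub_right_comm]
  rw [tsum_congr hk, ENNReal.tsum_mul_left, lintegral_tsum]
  intro k
  unfold shiftComb
  exact (by fun_prop : Measurable _).aemeasurable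

/-! ### Density and conclusion -/

/-- The frame inequalities extend from a dense set. -/
theorem frame_inequality_of_dense {ι H : Type*} [NormedAddCommGroup H] [InnerProductSpace ℂ H]
    {e : ι → H} {A B : ℝ} {D : Set H} (hD : Dense D)
    (h : ∀ f ∈ D, Summable (fun i => ‖inner ℂ (e i) f‖ ^ 2) ∧
      A * ‖f‖ ^ 2 ≤ ∑' i, ‖inner ℂ (e i) f‖ ^ 2 ∧ ∑' i, ‖inner ℂ (e i) f‖ ^ 2 ≤ B * ‖f‖ ^ 2)
    (f : H) : Summable (fun i => ‖inner ℂ (e i) f‖ ^ 2) ∧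
      A * ‖f‖ ^ 2 ≤ ∑' i, ‖inner ℂ (e i) f‖ ^ 2 ∧ ∑' i, ‖inner ℂ (e i) f‖ ^ 2 ≤ B * ‖f‖ ^ 2 := by
  -- For a finite partial sum the upper bound is a closed condition. It makes the analysis operator
  -- `C₀` bounded, after which the lower bound is a closed condition too.
  have hfin : ∀ (T : Finset ι) (f : H), ∑ i ∈ T, ‖inner ℂ (e i) f‖ ^ 2 ≤ B * ‖f‖ ^ 2 := by
    intro T
    have hcl : IsClosed {f : H | ∑ i ∈ T, ‖inner ℂ (e i) f‖ ^ 2 ≤ B * ‖f‖ ^ 2} :=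
      isClosed_le (by fun_prop) (by fun_prop)
    exact fun f => closure_minimal (fun g hg => ((h g hg).1.sum_le_tsum T fun _ _ => by
      positivity).trans (h g hg).2.2) hcl (hD f)
  have hsum : ∀ f : H, Summable (fun i => ‖inner ℂ (e i) f‖ ^ 2) := fun f =>
    summable_of_sum_le (fun _ => by positivity) fun T => hfin T f
  have hub : ∀ f : H, ∑' i, ‖inner ℂ (e i) f‖ ^ 2 ≤ B * ‖f‖ ^ 2 := fun f =>
    (hsum f).tsum_le_of_sum_le fun T => hfin T f
  refine ⟨hsum f, ?_, hub f⟩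
  have hmem : ∀ f : H, Memℓp (E := fun _ : ι => ℂ) (fun i => inner ℂ (e i) f) 2 := fun f =>
    memℓp_gen (by simpa using hsum f)
  set C₀ : H →ₗ[ℂ] lp (fun _ : ι => ℂ) 2 :=
    { toFun := fun f => ⟨fun i => inner ℂ (e i) f, hmem f⟩
      map_add' := fun f g => Subtype.ext (funext fun i => inner_add_right (e i) f g)
      map_smul' := fun c f => Subtype.ext (funext fun i => inner_smul_right (e i) f c) }
  have hnorm : ∀ f, ‖C₀ f‖ ^ 2 = ∑' i, ‖inner ℂ (e i) f‖ ^ 2 := fun f => by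
    have : ‖C₀ f‖ ^ 2 = ∑' i, ‖C₀ f i‖ ^ 2 := by
      simpa using lp.norm_rpow_eq_tsum (p := 2) (by norm_num) (C₀ f)
    exact this
  have hC : Continuous C₀ := by
    refine AddMonoidHomClass.continuous_of_bound C₀ √B fun f => ?_
    by_cases hB : 0 ≤ B
    · refine le_of_sq_le_sq ?_ (by positivity)
      rw [hnorm, mul_pow, Real.sq_sqrt hB]
      exact hub f
    -- A negative `B` forces `C₀ f = 0`.
    · have h0 : ‖C₀ f‖ ^ 2 ≤ 0 := by
        rw [hnorm]
        exact (hub f).trans (mul_nonpos_of_nonpos_of_nonneg (not_le.1 hB).le (by positivity))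
      have : ‖C₀ f‖ = 0 := by simpa using le_antisymm h0 (by positivity)
      rw [this]
      positivity
  rw [← hnorm]
  have hcl : IsClosed {f : H | A * ‖f‖ ^ 2 ≤ ‖C₀ f‖ ^ 2} := isClosed_le (by fun_prop) (by fun_prop)
  exact closure_minimal (fun g hg => by
    rw [Set.mem_ofPred_eq, hnorm]; exact (h g hg).2.1) hcl (hD f)

theorem dense_continuous_hasCompactSupport :
    Dense {f : L2R | ∃ (g : ℝ → ℂ) (hg : MemLp g 2), Continuous g ∧ HasCompactSupport g ∧
      f = hg.toLp g} := by
  refine fun f => EMetric.mem_closure_iff.2 fun ε hε => ?_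
  -- The minimum with `1` keeps the error finite when `ε = ∞`.
  obtain ⟨g, hgs, hg, hgc, hgm⟩ := (Lp.memLp f).exists_hasCompactSupport_eLpNorm_sub_le
    (by norm_num) (ε := min 1 (ε / 2)) (lt_min one_pos (ENNReal.half_pos hε.ne')).ne'
  refine ⟨hgm.toLp g, ⟨g, hgm, hgc, hgs, rfl⟩, ?_⟩
  rw [Lp.edist_def, eLpNorm_congr_ae (EventuallyEq.rfl.sub hgm.coeFn_toLp)]
  refine hg.trans_lt ?_
  by_cases hεt : ε = ∞
  · simp [hεt]
  · exact (min_le_right _ _).trans_lt (ENNReal.half_lt_self hε.ne' hεt)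

theorem summable_and_tsum_bounds_of_ennreal {ι : Type*} {a : ι → ℂ} {A B r : ℝ} (hA : 0 ≤ A)
    (hB : 0 ≤ B) (hr : 0 ≤ r)
    (h1 : ENNReal.ofReal A * ENNReal.ofReal r ≤ ∑' i, ‖a i‖ₑ ^ 2)
    (h2 : ∑' i, ‖a i‖ₑ ^ 2 ≤ ENNReal.ofReal B * ENNReal.ofReal r) :
    Summable (fun i => ‖a i‖ ^ 2) ∧ A * r ≤ ∑' i, ‖a i‖ ^ 2 ∧ ∑' i, ‖a i‖ ^ 2 ≤ B * r := by
  rw [← ENNReal.ofReal_mul hA] at h1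
  rw [← ENNReal.ofReal_mul hB] at h2
  have he : ∀ i, ‖a i‖ₑ ^ 2 = ENNReal.ofReal (‖a i‖ ^ 2) := fun i => by
    rw [ENNReal.ofReal_pow (norm_nonneg _), ofReal_norm]
  have hs : Summable (fun i => ‖a i‖ ^ 2) := by
    have := ENNReal.summable_toReal (h2.trans_lt ENNReal.ofReal_lt_top).ne
    exact this.congr fun i => by rw [he, ENNReal.toReal_ofReal (by positivity)]
  simp_rw [he] at h1 h2
  rw [← ENNReal.ofReal_tsum_of_nonneg (fun _ => by positivity) hs] at h1 h2
  have h0 : 0 ≤ ∑' i, ‖a i‖ ^ 2 := tsum_nonneg fun _ => by positivity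
  exact ⟨hs, (ENNReal.ofReal_le_ofReal_iff h0).1 h1,
    (ENNReal.ofReal_le_ofReal_iff (mul_nonneg hB hr)).1 h2⟩

theorem theorem2p5 (φ : ℝ → ℝ) (α β : ℝ) (hβ : 0 < β)
    (hφ : ClassA φ) (hstable : IsStableGenerator φ (1 / β))
    (hα : 0 < α) (hαM : α < 1 / (2 * √(bernsteinConst φ (1 / β)))) :
    IsFrameWithBounds (gaborSystem φ α β)
      (1 / α * (1 - 2 * α * √(bernsteinConst φ (1 / β))) ^ 2 *
        (essInf (fourierPeriodization φ β) (volume.restrict (Set.Icc 0 β))).toReal)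
      (1 / α * (1 + 2 * α * √(bernsteinConst φ (1 / β))) ^ 2 *
        (essSup (fourierPeriodization φ β) (volume.restrict (Set.Icc 0 β))).toReal) := by
  have hI0 := hφ.essInf_fourierPeriodization_ne_zero hβ hstable
  have hSt := hφ.essSup_fourierPeriodization_ne_top hβ hstable
  have hIS : essInf (fourierPeriodization φ β) (volume.restrict (Set.Icc 0 β)) ≤
      essSup (fourierPeriodization φ β) (volume.restrict (Set.Icc 0 β)) := by
    -- The comparison of `essInf` with `essSup` needs `[0, β]` to have positive measure.
    have : NeBot (ae ((volume : Measure ℝ).restrict (Set.Icc 0 β))) := by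
      rw [ae_neBot, Ne, Measure.restrict_eq_zero, Real.volume_Icc]
      simpa using hβ
    obtain ⟨w, h1, h2⟩ := ((ae_essInf_le (f := fourierPeriodization φ β)
      (μ := volume.restrict (Set.Icc 0 β))).and (ENNReal.ae_le_essSup _)).exists
    exact h1.trans h2
  have hfib := hφ.sampling_inequality_shiftComb hβ hstable hα
  set I := essInf (fourierPeriodization φ β) (volume.restrict (Set.Icc 0 β))
  set S := essSup (fourierPeriodization φ β) (volume.restrict (Set.Icc 0 β))
  set M := bernsteinConst φ (1 / β)
  have hθ : 2 * α * √M < 1 := by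
    rcases (Real.sqrt_nonneg M).eq_or_lt with h | h
    -- Here `√M = 0`, where the quotient bounding `α` takes the default value `0`; the claim is
    -- simply `0 < 1`.
    · simp [← h]
    · rw [lt_div_iff₀ (by positivity)] at hαM
      linarith
  set θ := 2 * α * √M
  have hθ0 : 0 ≤ θ := by positivity
  have hIt : I ≠ ∞ := ne_top_of_le_ne_top hSt hIS
  have hI : 0 < I.toReal := ENNReal.toReal_pos hI0 hIt
  have hS : 0 < S.toReal := ENNReal.toReal_pos (ne_bot_of_le_ne_bot hI0 hIS) hSt
  have hA : 0 < 1 / α * (1 - θ) ^ 2 * I.toReal := by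
    have : 0 < 1 - θ := by linarith
    positivity
  have hB : 0 < 1 / α * (1 + θ) ^ 2 * S.toReal := by positivity
  refine ⟨hA, hB, frame_inequality_of_dense dense_continuous_hasCompactSupport ?_⟩
  rintro _ ⟨f, hf, hfc, hfs, rfl⟩
  obtain ⟨s, hs⟩ := hfs.exists_finset_translates (one_div_pos.2 hβ)
  have hnorm : ENNReal.ofReal (‖hf.toLp f‖ ^ 2) = ∫⁻ x in Set.Ioc 0 (1 / β),
      ∑ j ∈ s, ‖f (x - 1 / β * j)‖ₑ ^ 2 := by
    rw [ENNReal.ofReal_pow (norm_nonneg _), ofReal_norm, sq_enorm_toLp hf]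
    exact lintegral_eq_setLIntegral_sum (one_div_pos.2 hβ) (g := fun x => ‖f x‖ₑ ^ 2)
      (by fun_prop) fun x hx j hj => by simp only [hs x hx j hj]; simp
  have hsumm := hφ.tsum_sq_inner_gaborSystem α hβ hf hfc hfs hs
  have hα0 : ENNReal.ofReal α ≠ 0 := (ENNReal.ofReal_pos.2 hα).ne'
  -- The factor `1/β` from Parseval in `m` cancels the `β` from the norm of the trigonometric
  -- polynomial over a period.
  have hbound : ∀ (C : ℝ) (K : ℝ≥0∞), K ≠ ∞ → ∀ x,
      ENNReal.ofReal (1 / β) * (ENNReal.ofReal (1 / α) * (ENNReal.ofReal (C ^ 2) *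
        (K * (ENNReal.ofReal β * ∑ j ∈ s, ‖f (x - 1 / β * j)‖ₑ ^ 2)))) =
      ENNReal.ofReal (1 / α * C ^ 2 * K.toReal) * ∑ j ∈ s, ‖f (x - 1 / β * j)‖ₑ ^ 2 :=
    fun C K hK x => by
      have h1 : ENNReal.ofReal (1 / β) * ENNReal.ofReal β = 1 := by
        rw [← ENNReal.ofReal_mul (by positivity), one_div_mul_cancel hβ.ne', ENNReal.ofReal_one]
      rw [ENNReal.ofReal_mul (by positivity), ENNReal.ofReal_mul (by positivity),
        ENNReal.ofReal_toReal hK]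
      calc _ = (ENNReal.ofReal (1 / β) * ENNReal.ofReal β) * (ENNReal.ofReal (1 / α) *
          (ENNReal.ofReal (C ^ 2) * (K * ∑ j ∈ s, ‖f (x - 1 / β * j)‖ₑ ^ 2))) := by ring
        _ = _ := by rw [h1]; ring
  have hcancel : ∀ z : ℝ≥0∞, ENNReal.ofReal (1 / α) * (ENNReal.ofReal α * z) = z := fun z => by
    rw [← mul_assoc, ← ENNReal.ofReal_mul (by positivity), one_div_mul_cancel hα.ne',
      ENNReal.ofReal_one, one_mul]
  refine summable_and_tsum_bounds_of_ennreal hA.le hB.le (by positivity) ?_ ?_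
  · rw [hnorm, hsumm, ← lintegral_const_mul' _ _ ENNReal.ofReal_ne_top,
      ← lintegral_const_mul' _ _ ENNReal.ofReal_ne_top]
    refine lintegral_mono fun x => ?_
    simp only
    rw [← hbound _ I hIt, ← hcancel (∑' k : ℤ, _)]
    exact mul_le_mul' le_rfl (mul_le_mul' le_rfl (hfib hθ.le s _ x).1)
  · rw [hnorm, hsumm, ← lintegral_const_mul' _ _ ENNReal.ofReal_ne_top,
      ← lintegral_const_mul' _ _ ENNReal.ofReal_ne_top]
    refine lintegral_mono fun x => ?_
    simp only
    rw [← hbound _ S hSt, ← hcancel (∑' k : ℤ, _)]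
    exact mul_le_mul' le_rfl (mul_le_mul' le_rfl (hfib hθ.le s _ x).2)
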